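/- Let $\Sigma,\Gamma$ be finite alphabets and let $\mathcal A$ be a deterministic Muller automaton over $\omega$-words with alphabet $\Sigma\times\Gamma$. Let $\forall^{*}\mathrm L(\mathcal A)\subseteq\Sigma^\omega$ be the set of all $\alpha\in\Sigma^\omega$ such that the set $\{\beta\in\Gamma^\omega \mid (\alpha,\beta)\in \mathrm L(\mathcal A)\}$ is comeager in $\Gamma^\omega$ (product topology, $\Gamma$ discrete). Then $\forall^{*}\mathrm L(\mathcal A)$ is $\omega$-regular, i.e. a finite union of languages $U\cdot V^\omega$ with $U,V\subseteq\Sigma^*$ regular. Moreover, one can effectively construct from $\mathcal A$ an alternating Muller automaton $\mathcal B$ over $\Sigma$ with $\mathrm L(\mathcal B)=\forall^{*}\mathrm L(\mathcal A)$ whose size is polynomial in the size of $\mathcal A$. Here an alternating Muller automaton has transitions $\delta(q,a)$ that are expressions built from states by $\wedge$ and $\vee$, and it accepts $\alpha$ if Player $\exists$ has a winning strategy in the game in which $\exists$ resolves the disjunctions, $\forall$ resolves the conjunctions, and $\exists$ wins if the set of states visited infinitely often belongs to the Muller condition. In precise terms, there are a computable function on codes of automata, mapping each $\mathcal A$ to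 such a $\mathcal B$, and a polynomial $p$ with $|Q_{\mathcal B}|\le p(|Q_{\mathcal A}|)$, with $g(\mathcal B)\le p(g(\mathcal A))$, where $g$ is the number of letters and states plus the size of the transition function (number of entries of the transition table of $\mathcal A$, total number of nodes of the transition expressions of $\mathcal B$), and with $g(\mathcal B)+|\psi|\le p(g(\mathcal A)+|\varphi|)$, where $\varphi$ and $\psi$ are the Boolean formulas over the states by which the Muller conditions of $\mathcal A$ and $\mathcal B$ are given. -/

import Mathlib

open Filter

/-- The elements that occur infinitely often in a sequence. -/
def infOcc {Q : Type*} (ρ : ℕ → Q) : Set Q :=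
  {q | ∃ᶠ i in atTop, ρ i = q}

/-! ### Deterministic Muller automata on infinite words -/

/-- A deterministic Muller automaton over the alphabet `A` with set of states `Q`. -/
structure DetMuller (A Q : Type*) where
  init : Q
  step : Q → A → Q
  acc : Set (Set Q)

namespace DetMuller

variable {A Q : Type*}

/-- The unique run on a word. -/
def run (M : DetMuller A Q) (w : ℕ → A) : ℕ → Q
  | 0 => M.init
  | i + 1 => M.step (run M w i) (w i)

/-- The words whose run has its set of infinitely repeated states in the Muller condition. -/
def language (M : DetMuller A Q) : Set (ℕ → A) :=
  {w | infOcc (M.run w) ∈ M.acc}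

end DetMuller

/-! ### The category quantifier -/

/-- A set of infinite words is comeager: its complement is meager in the product of discrete
spaces. -/
def IsComeagerLang {G : Type*} (L : Set (ℕ → G)) : Prop :=
  letI : TopologicalSpace G := ⊥
  IsMeagre Lᶜ

/-- The words `α` over `S` whose section `{β | (α, β) ∈ L}` is comeager. -/
def forallStar {S G : Type*} (L : Set (ℕ → S × G)) : Set (ℕ → S) :=
  {α | IsComeagerLang {β : ℕ → G | (fun i => (α i, β i)) ∈ L}}

/-! ### Omega-regular languages -/

/-- The finite word `α i, α (i + 1), …, α (j - 1)`. -/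
def wordFactor {S : Type*} (α : ℕ → S) (i j : ℕ) : List S :=
  (List.range' i (j - i)).map α

/-- The language `U · V^ω`: infinite words that factor as a word of `U` followed by infinitely
many non-empty words of `V`. -/
def mulOmegaPow {S : Type*} (U V : Language S) : Set (ℕ → S) :=
  {α | ∃ t : ℕ → ℕ, StrictMono t ∧ wordFactor α 0 (t 0) ∈ U ∧
    ∀ i, wordFactor α (t i) (t (i + 1)) ∈ V}

/-- A language of infinite words is omega-regular if it is a finite union of languages `U · V^ω`
with `U` and `V` regular languages of finite words. -/
def IsOmegaRegular {S : Type*} (L : Set (ℕ → S)) : Prop :=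
  ∃ (n : ℕ) (U V : Fin n → Language S),
    (∀ i, (U i).IsRegular ∧ (V i).IsRegular) ∧ L = ⋃ i, mulOmegaPow (U i) (V i)

/-! ### Alternating Muller automata on infinite words -/

/-- Positive Boolean expressions (without constants) over `X`. -/
inductive DL (X : Type*) where
  | atom (x : X) : DL X
  | and (e₁ e₂ : DL X) : DL X
  | or (e₁ e₂ : DL X) : DL X

/-- The number of nodes of a positive Boolean expression. -/
def DL.size {X : Type*} : DL X → ℕ
  | .atom _ => 1
  | .and e₁ e₂ => e₁.size + e₂.size + 1
  | .or e₁ e₂ => e₁.size + e₂.size + 1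

/-- An alternating Muller automaton over the alphabet `A` with set of states `Q`. -/
structure AltMuller (A Q : Type*) where
  init : Q
  step : Q → A → DL Q
  acc : Set (Set Q)

namespace AltMuller

variable {A Q : Type*}

/-- Configurations of the acceptance game: a position in the word together with a state, or
together with an expression. -/
inductive Conf (Q : Type*) where
  | state (n : ℕ) (q : Q) : Conf Q
  | form (n : ℕ) (e : DL Q) : Conf Q

/-- The possible moves of the acceptance game on the word `w`. The only choices are those between
the two components of a conjunction or of a disjunction. -/
inductive Move (B : AltMuller A Q) (w : ℕ → A) : Conf Q → Conf Q → Prop where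
  | read (n : ℕ) (q : Q) : Move B w (.state n q) (.form (n + 1) (B.step q (w n)))
  | atom (n : ℕ) (q : Q) : Move B w (.form n (.atom q)) (.state n q)
  | andLeft (n : ℕ) (e₁ e₂ : DL Q) : Move B w (.form n (.and e₁ e₂)) (.form n e₁)
  | andRight (n : ℕ) (e₁ e₂ : DL Q) : Move B w (.form n (.and e₁ e₂)) (.form n e₂)
  | orLeft (n : ℕ) (e₁ e₂ : DL Q) : Move B w (.form n (.or e₁ e₂)) (.form n e₁)
  | orRight (n : ℕ) (e₁ e₂ : DL Q) : Move B w (.form n (.or e₁ e₂)) (.form n e₂)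

/-- Infinite plays of the acceptance game on the word `w`. -/
def IsPlay (B : AltMuller A Q) (w : ℕ → A) (π : ℕ → Conf Q) : Prop :=
  π 0 = .state 0 B.init ∧ ∀ i, B.Move w (π i) (π (i + 1))

/-- The play `π` follows the strategy `σ` of the existential player, who owns the disjunctions.
The strategy looks at the history `π 0, …, π i` and picks the left (`true`) or the right (`false`)
component. -/
def Consistent (σ : List (Conf Q) → Bool) (π : ℕ → Conf Q) : Prop :=
  ∀ (i n : ℕ) (e₁ e₂ : DL Q), π i = .form n (.or e₁ e₂) →
    π (i + 1) = .form n (if σ ((List.range (i + 1)).map π) = true then e₁ else e₂)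

/-- The states that occur infinitely often in a play. -/
def playInf (π : ℕ → Conf Q) : Set Q :=
  {q | ∃ᶠ i in atTop, ∃ n, π i = .state n q}

/-- The words on which the existential player has a winning strategy in the acceptance game. -/
def language (B : AltMuller A Q) : Set (ℕ → A) :=
  {w | ∃ σ : List (Conf Q) → Bool,
    ∀ π : ℕ → Conf Q, B.IsPlay w π → Consistent σ π → playInf π ∈ B.acc}

end AltMuller

/-! ### Finite presentations of automata, their sizes and their codes -/

/-- Boolean formulas over the set of states, used to write down Muller conditions. -/
inductive AccFormula (Q : Type*) where
  | fls : AccFormula Q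
  | atom (q : Q) : AccFormula Q
  | neg (φ : AccFormula Q) : AccFormula Q
  | and (φ ψ : AccFormula Q) : AccFormula Q
  | or (φ ψ : AccFormula Q) : AccFormula Q

namespace AccFormula

variable {Q : Type*}

/-- The family of sets of states described by a formula; the atom `q` says that `q` belongs to
the set. -/
def family : AccFormula Q → Set (Set Q)
  | fls => ∅
  | atom q => {F | q ∈ F}
  | neg φ => (family φ)ᶜ
  | and φ ψ => family φ ∩ family ψ
  | or φ ψ => family φ ∪ family ψ

/-- Every Muller condition on a finite set of states is described by a formula. -/
theorem exists_family_eq [Finite Q] (𝓕 : Set (Set Q)) : ∃ φ : AccFormula Q, φ.family = 𝓕 := by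
  have key : ∀ F T : Set Q, ∃ φ : AccFormula Q, ∀ X, X ∈ φ.family ↔ ∀ q ∈ T, (q ∈ X ↔ q ∈ F) := by
    intro F T
    induction T, T.toFinite using Set.Finite.induction_on with
    | empty => exact ⟨neg fls, fun X => by simp [family]⟩
    | @insert a T _ _ ih =>
      obtain ⟨φ, hφ⟩ := ih
      by_cases ha : a ∈ F
      · exact ⟨and (atom a) φ, fun X => by simp [family, hφ, ha]⟩
      · exact ⟨and (neg (atom a)) φ, fun X => by simp [family, hφ, ha]⟩
  induction 𝓕, 𝓕.toFinite using Set.Finite.induction_on with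
  | empty => exact ⟨fls, rfl⟩
  | @insert F 𝓕 _ _ ih =>
    obtain ⟨φ, hφ⟩ := ih
    obtain ⟨ψ, hψ⟩ := key F Set.univ
    refine ⟨or ψ φ, ?_⟩
    ext X
    simp [family, hφ, hψ, Set.ext_iff]

/-- The number of nodes of a formula. -/
def size : AccFormula Q → ℕ
  | fls => 1
  | atom _ => 1
  | neg φ => size φ + 1
  | and φ ψ => size φ + size ψ + 1
  | or φ ψ => size φ + size ψ + 1

/-- Prefix notation. -/
def code {n : ℕ} : AccFormula (Fin n) → List ℕ
  | fls => [0]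
  | neg φ => 1 :: code φ
  | and φ ψ => 2 :: (code φ ++ code ψ)
  | or φ ψ => 3 :: (code φ ++ code ψ)
  | atom q => [(q : ℕ) + 4]

end AccFormula

/-- Prefix notation. -/
def DL.code {n : ℕ} : DL (Fin n) → List ℕ
  | .and e₁ e₂ => 0 :: (DL.code e₁ ++ DL.code e₂)
  | .or e₁ e₂ => 1 :: (DL.code e₁ ++ DL.code e₂)
  | .atom q => [(q : ℕ) + 2]

/-- Codes of deterministic Muller automata over a product alphabet: numbers of letters of the two
alphabets, number of states, initial state, transition table, Muller condition. -/
abbrev DetCode : Type := ℕ × ℕ × ℕ × ℕ × List ℕ × List ℕ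

/-- The code of `M`, with its Muller condition written as the formula `φ`. -/
def DetMuller.code {k m n : ℕ} (M : DetMuller (Fin k × Fin m) (Fin n))
    (φ : AccFormula (Fin n)) : DetCode :=
  (k, m, n, (M.init : ℕ),
    (List.finRange n).flatMap (fun q => (List.finRange k).flatMap (fun a =>
      (List.finRange m).map (fun b => (M.step q (a, b) : ℕ)))),
    φ.code)

/-- Codes of alternating Muller automata: number of letters, number of states, initial state,
transition table, Muller condition. -/
abbrev AltCode : Type := ℕ × ℕ × ℕ × List (List ℕ) × List ℕ

/-- The code of `B`, with its Muller condition written as the formula `ψ`. -/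
def AltMuller.code {k n : ℕ} (B : AltMuller (Fin k) (Fin n))
    (ψ : AccFormula (Fin n)) : AltCode :=
  (k, n, (B.init : ℕ),
    (List.finRange n).flatMap (fun q => (List.finRange k).map (fun a => (B.step q a).code)),
    ψ.code)

/-- The size of a deterministic automaton without its Muller condition: letters, states, and
entries of the transition table. -/
def DetMuller.graphSize {k m n : ℕ} (_M : DetMuller (Fin k × Fin m) (Fin n)) : ℕ :=
  k + m + n + n * k * m

/-- The size of an alternating automaton without its Muller condition: letters, states, and the
total size of the transition expressions. -/
def AltMuller.graphSize {k n : ℕ} (B : AltMuller (Fin k) (Fin n)) : ℕ :=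
  k + n + ∑ q, ∑ a, (B.step q a).size

/-!
Fix a word `α` over the first alphabet. The runs of the automaton on the words `(α, β)` are the
paths of a *position graph*, whose vertices are pairs of a time and a state. The *limit set* of a
position consists of the states that can be reached from it at arbitrarily late times. Limit sets
only shrink along paths, and a position is a *bottom* position if its limit set shrinks no more.
A generic path loses every state it can lose, so it runs into a bottom position, and from there it
visits every state of the limit set infinitely often and no other one
(`DetMuller.Generic.infOcc_eq`, `DetMuller.Generic.exists_isBottom`). As comeagerly many `β` give
generic runs and finite prefixes are arbitrary, the section over `α` is comeager if and only if each
reachable bottom position has an accepting limit set (`DetMuller.mem_forallStar_iff`).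

*Omega-regularity.* This criterion only depends on the reachability relations, and the relations
"visited on the way", of the factors in any factorization of `α`
(`DetMuller.bottomsAccept_of_shape_eq`). A finite automaton computes these relations, and by
Ramsey's theorem every word has a factorization in which all factors but the first have the same
ones. So the language is a finite union of languages `U · V^ω`
(`isOmegaRegular_of_saturated`).

*The alternating automaton.* It plays the Banach–Mazur game on `β`: the universal and the
existential player alternately choose finite non-empty pieces of `β`, with the universal player
moving first. Its states are the given ones with a phase that names the player to move; a player
who never passes the move on loses. Each player can force a generic run: in the phase after `c`
hand-overs, head for the `c`-th target along a shortest path (`DetMuller.exists_rule`). If all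
reachable bottom positions accept, this wins for the existential player; otherwise the universal
player first goes to a rejecting bottom position and then forces a generic run
(`IsBanachMazur.language_eq`). The code of this automaton is obtained from the given code by a
primitive recursive function (`primrec_gameCode`, `DetMuller.gameCode_code`).
-/

/-! ### The position graph of a deterministic automaton over a product alphabet -/

namespace DetMuller

variable {S G Q : Type*} (M : DetMuller (S × G) Q) (α : ℕ → S)

/-- The edges of the position graph along `α`: in position `(n, q)` some letter of `G` is chosen
and the automaton reads it together with `α n`. -/
def Edge (x y : ℕ × Q) : Prop :=
  ∃ b, y = (x.1 + 1, M.step x.2 (α x.1, b))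

/-- Reachability, in zero or more steps, in the position graph along `α`. -/
def Reach : ℕ × Q → ℕ × Q → Prop :=
  Relation.ReflTransGen (M.Edge α)

/-- The states that can be reached from the position `x` at arbitrarily late times. -/
def limitSet (x : ℕ × Q) : Set Q :=
  {r | ∀ N, ∃ j ≥ N, M.Reach α x (j, r)}

/-- A position is a bottom position if the limit set never shrinks after it. -/
def IsBottom (x : ℕ × Q) : Prop :=
  ∀ y, M.Reach α x y → M.limitSet α y = M.limitSet α x

/-- Every bottom position that is reachable from the initial one has an accepting limit set. -/
def BottomsAccept : Prop :=
  ∀ x, M.Reach α (0, M.init) x → M.IsBottom α x → M.limitSet α x ∈ M.acc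

/-- The sets of positions that a generic play has to meet whenever it can: for each state `r`, the
positions with state `r`, and the positions from which `r` is lost in the limit. -/
def target : Q ⊕ Q → Set (ℕ × Q)
  | .inl r => {x | x.2 = r}
  | .inr r => {x | r ∉ M.limitSet α x}

/-- A sequence of states is generic if, again and again, it visits each target or gets to a position
from which no path leads to the target. -/
def Generic (ρ : ℕ → Q) : Prop :=
  ∀ d N, ∃ m ≥ N, (m, ρ m) ∈ M.target α d ∨
    ∀ y, Relation.TransGen (M.Edge α) (m, ρ m) y → y ∉ M.target α d

variable {M α}

theorem Reach.fst_le {x y : ℕ × Q} (h : M.Reach α x y) : x.1 ≤ y.1 := by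
  induction h with
  | refl => exact le_rfl
  | tail _ h ih => obtain ⟨b, rfl⟩ := h; exact ih.trans (Nat.le_succ _)

theorem Reach.trans {x y z : ℕ × Q} (h : M.Reach α x y) (h' : M.Reach α y z) : M.Reach α x z :=
  Relation.ReflTransGen.trans h h'

theorem Reach.limitSet_subset {x y : ℕ × Q} (h : M.Reach α x y) :
    M.limitSet α y ⊆ M.limitSet α x := by
  intro r hr N
  obtain ⟨j, hj, hr⟩ := hr N
  exact ⟨j, hj, h.trans hr⟩

theorem IsBottom.of_reach {x y : ℕ × Q} (h : M.IsBottom α x) (hxy : M.Reach α x y) :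
    M.IsBottom α y := fun z hz => by rw [h z (hxy.trans hz), h y hxy]

/-- The path can be taken to be non-empty because it may end as late as desired. -/
theorem exists_transGen_of_mem_limitSet {x : ℕ × Q} {r : Q} (h : r ∈ M.limitSet α x) :
    ∃ j, Relation.TransGen (M.Edge α) x (j, r) := by
  obtain ⟨j, hj, hr⟩ := h (x.1 + 1)
  refine ⟨j, ?_⟩
  rcases Relation.reflTransGen_iff_eq_or_transGen.1 hr with h | h
  · rw [← h] at hj; simp at hj
  · exact h

theorem reach_of_path {ρ : ℕ → Q} (hρ : ∀ n, M.Edge α (n, ρ n) (n + 1, ρ (n + 1))) {m n : ℕ}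
    (h : m ≤ n) : M.Reach α (m, ρ m) (n, ρ n) := by
  induction n, h using Nat.le_induction with
  | base => exact .refl
  | succ n _ ih => exact ih.tail (hρ n)

/-- The states repeated infinitely often by a generic path are those of the limit set of any bottom
position on it. -/
theorem Generic.infOcc_eq {ρ : ℕ → Q} (hg : M.Generic α ρ)
    (hρ : ∀ n, M.Edge α (n, ρ n) (n + 1, ρ (n + 1))) {m : ℕ} (hm : M.IsBottom α (m, ρ m)) :
    infOcc ρ = M.limitSet α (m, ρ m) := by
  ext r
  constructor
  · intro h N
    obtain ⟨j, hj, rfl⟩ := frequently_atTop.1 h (max N m)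
    exact ⟨j, (le_max_left _ _).trans hj, reach_of_path hρ ((le_max_right _ _).trans hj)⟩
  · intro h
    refine frequently_atTop.2 fun N => ?_
    obtain ⟨k, hk, h' | h'⟩ := hg (.inl r) (max N m)
    · exact ⟨k, (le_max_left _ _).trans hk, h'⟩
    · rw [← hm _ (reach_of_path hρ ((le_max_right _ _).trans hk))] at h
      obtain ⟨j, hj⟩ := exists_transGen_of_mem_limitSet h
      exact absurd rfl (h' _ hj)

/-- A generic path runs into a bottom position, because it loses every state that it can lose. -/
theorem Generic.exists_isBottom [Finite Q] {ρ : ℕ → Q} (hg : M.Generic α ρ)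
    (hρ : ∀ n, M.Edge α (n, ρ n) (n + 1, ρ (n + 1))) : ∃ m, M.IsBottom α (m, ρ m) := by
  choose f _ hf using fun r => hg (.inr r) 0
  obtain ⟨m, hm⟩ := (Set.finite_range f).bddAbove
  refine ⟨m, fun y hy => hy.limitSet_subset.antisymm fun r hr => ?_⟩
  have hr' := reach_of_path hρ (hm ⟨r, rfl⟩)
  rcases hf r with h | h
  · exact absurd (hr'.limitSet_subset hr) h
  · rcases Relation.reflTransGen_iff_eq_or_transGen.1 (hr'.trans hy) with h' | h'
    · rw [h']; exact hr'.limitSet_subset hr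
    · exact not_not.1 (h _ h')

/-! ### Comeager sections -/

theorem run_succ_edge (β : ℕ → G) (n : ℕ) :
    M.Edge α (n, M.run (fun i => (α i, β i)) n) (n + 1, M.run (fun i => (α i, β i)) (n + 1)) :=
  ⟨β n, rfl⟩

theorem run_congr {β β' : ℕ → G} {n : ℕ} (h : ∀ i < n, β i = β' i) :
    M.run (fun i => (α i, β i)) n = M.run (fun i => (α i, β' i)) n := by
  induction n with
  | zero => rfl
  | succ n ih => simp only [run]; rw [ih fun i hi => h i (by omega), h n (by omega)]

/-- Every path of the position graph that starts on a run is followed by some run. -/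
theorem exists_run_of_reach (β : ℕ → G) {m : ℕ} {y : ℕ × Q}
    (h : M.Reach α (m, M.run (fun i => (α i, β i)) m) y) :
    ∃ β' : ℕ → G, (∀ i < m, β' i = β i) ∧ M.run (fun i => (α i, β' i)) y.1 = y.2 := by
  induction h with
  | refl => exact ⟨β, fun _ _ => rfl, rfl⟩
  | @tail y z hy hz ih =>
    obtain ⟨β', hβ', hr⟩ := ih
    obtain ⟨b, rfl⟩ := hz
    have hm : m ≤ y.1 := Reach.fst_le hy
    refine ⟨Function.update β' y.1 b, fun i hi => ?_, ?_⟩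
    · rw [Function.update_of_ne (by omega), hβ' i hi]
    · simp only [run, Function.update_self]
      rw [run_congr (β' := β') fun i hi => Function.update_of_ne (by omega) _ _, hr]

/-- For each target and each time bound, the words whose run meets the target or loses it after
that time form a dense open set; there are countably many such sets. -/
theorem eventually_residual_generic [Finite Q] [TopologicalSpace G] [DiscreteTopology G] :
    ∀ᶠ β in residual (ℕ → G), M.Generic α (M.run fun i => (α i, β i)) := by
  simp only [Generic]
  refine eventually_all.2 fun d => eventually_countable_forall.2 fun N => ?_
  refine residual_of_dense_open ?_ ?_
  · -- the run up to time `m` only depends on the first `m` letters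
    refine isOpen_iff_mem_nhds.2 fun β hβ => ?_
    obtain ⟨m, hm, h⟩ := hβ
    refine Filter.mem_of_superset
      ((PiNat.isOpen_cylinder (fun _ => G) β m).mem_nhds (PiNat.self_mem_cylinder β m)) ?_
    intro β' hβ'
    refine ⟨m, hm, ?_⟩
    rwa [run_congr (PiNat.mem_cylinder_iff.1 hβ')]
  · refine (PiNat.isTopologicalBasis_cylinders (fun _ => G)).dense_iff.2 ?_
    rintro _ ⟨β, n, rfl⟩ -
    -- if the target can still be met after the prefix, some continuation meets it
    by_cases h : ∀ y, Relation.TransGen (M.Edge α)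
        (max N n, M.run (fun i => (α i, β i)) (max N n)) y → y ∉ M.target α d
    · exact ⟨β, PiNat.self_mem_cylinder β n, max N n, le_max_left _ _, .inr h⟩
    · push Not at h
      obtain ⟨y, hy, hd⟩ := h
      obtain ⟨β', hβ', hr⟩ := exists_run_of_reach β hy.to_reflTransGen
      have hle : max N n ≤ y.1 := Reach.fst_le hy.to_reflTransGen
      refine ⟨β', PiNat.mem_cylinder_iff.2 fun i hi => hβ' i (lt_max_of_lt_right hi), y.1,
        (le_max_left _ _).trans hle, .inl ?_⟩
      rwa [hr]

/-- The section over `α` is comeager exactly if all reachable bottom positions accept. -/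
theorem mem_forallStar_iff [Finite Q] [Finite G] [Nonempty G] :
    α ∈ forallStar M.language ↔ M.BottomsAccept α := by
  let _ : TopologicalSpace G := ⊥
  have : DiscreteTopology G := ⟨rfl⟩
  have hL : α ∈ forallStar M.language ↔
      ∀ᶠ β in residual (ℕ → G), infOcc (M.run fun i => (α i, β i)) ∈ M.acc := by
    simp only [forallStar, IsComeagerLang, IsMeagre, Set.mem_ofPred_eq, compl_compl]
    rfl
  rw [hL]
  constructor
  · -- a comeager set meets the cylinder of words whose run passes through `x`
    intro h x hx hb
    obtain ⟨β₀⟩ : Nonempty (ℕ → G) := inferInstance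
    obtain ⟨β₁, -, hβ₁⟩ := exists_run_of_reach (m := 0) β₀ hx
    have hd : Dense {β : ℕ → G | infOcc (M.run fun i => (α i, β i)) ∈ M.acc ∧
        M.Generic α (M.run fun i => (α i, β i))} :=
      dense_of_mem_residual (h.and eventually_residual_generic)
    obtain ⟨β, hβ, hacc, hg⟩ := hd.inter_open_nonempty _
      (PiNat.isOpen_cylinder (fun _ => G) β₁ x.1) ⟨β₁, PiNat.self_mem_cylinder β₁ x.1⟩
    have hx' : (x.1, M.run (fun i => (α i, β i)) x.1) = x := by
      rw [run_congr (PiNat.mem_cylinder_iff.1 hβ), hβ₁]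
    have := hg.infOcc_eq (run_succ_edge β) (m := x.1) (by rwa [hx'])
    rwa [this, hx'] at hacc
  · intro h
    filter_upwards [eventually_residual_generic (M := M) (α := α)] with β hβ
    obtain ⟨m, hm⟩ := hβ.exists_isBottom (run_succ_edge β)
    rw [hβ.infOcc_eq (run_succ_edge β) hm]
    exact h _ (reach_of_path (ρ := M.run fun i => (α i, β i)) (run_succ_edge β) (Nat.zero_le m)) hm

theorem forallStar_language_of_isEmpty [IsEmpty G] : forallStar M.language = Set.univ := by
  refine Set.eq_univ_of_forall fun α => ?_
  simp only [forallStar, IsComeagerLang, Set.mem_ofPred_eq]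
  convert @IsMeagre.empty (ℕ → G) (@Pi.topologicalSpace ℕ (fun _ => G) fun _ => ⊥) using 1
  exact Set.eq_empty_of_forall_notMem fun β => isEmptyElim (β 0)

end DetMuller

/-! ### Omega-regularity -/

theorem mulOmegaPow_univ {S : Type*} : mulOmegaPow (Set.univ : Set (List S)) Set.univ = Set.univ :=
  Set.eq_univ_of_forall fun _ => ⟨id, strictMono_id, trivial, fun _ => trivial⟩

theorem wordFactor_self {S : Type*} (α : ℕ → S) (i : ℕ) : wordFactor α i i = [] := by
  simp [wordFactor]

theorem wordFactor_succ {S : Type*} (α : ℕ → S) {i j : ℕ} (h : i ≤ j) :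
    wordFactor α i (j + 1) = wordFactor α i j ++ [α j] := by
  have : j + 1 - i = (j - i) + 1 := by omega
  rw [wordFactor, wordFactor, this, List.range'_1_concat, List.map_append]
  simp [Nat.add_sub_cancel' h]

/-- A weak form of the infinite Ramsey theorem for a finite colouring of the pairs `i < j`: some
subsequence has all its pairs of neighbours in one colour. -/
theorem exists_strictMono_color_eq {T : Type*} [Finite T] (c : ℕ → ℕ → T) :
    ∃ (t : ℕ → ℕ) (e : T), StrictMono t ∧ ∀ i, c (t i) (t (i + 1)) = e := by
  have key : ∀ (C : Set T) (f : ℕ → ℕ), StrictMono f → (∀ i j, i < j → c (f i) (f j) ∈ C) →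
      ∃ (t : ℕ → ℕ) (e : T), StrictMono t ∧ ∀ i, c (t i) (t (i + 1)) = e := by
    intro C
    induction C, C.toFinite using Set.Finite.induction_on with
    | empty => intro f _ h; exact absurd (h 0 1 one_pos) (Set.notMem_empty _)
    | @insert e C _ _ ih =>
      intro f hf h
      obtain ⟨g, hg | hg⟩ := exists_increasing_or_nonincreasing_subseq' (fun i j => c i j = e) f
      · exact ⟨f ∘ g, e, hf.comp g.strictMono, hg⟩
      · refine ih (f ∘ g) (hf.comp g.strictMono) fun i j hij => ?_
        exact (h _ _ (g.strictMono hij)).resolve_left (hg i j hij)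
  exact key Set.univ id strictMono_id fun _ _ _ => trivial

/-- A language is omega-regular if a finite automaton on finite words saturates it: whether an
infinite word belongs to it only depends on the states that the automaton reaches on the factors
of a factorization. -/
theorem isOmegaRegular_of_saturated {S T : Type*} [Finite T] (D : DFA S T) (L : Set (ℕ → S))
    (h : ∀ (α α' : ℕ → S) (t t' : ℕ → ℕ), StrictMono t → StrictMono t' →
      D.eval (wordFactor α 0 (t 0)) = D.eval (wordFactor α' 0 (t' 0)) →
      (∀ i, D.eval (wordFactor α (t i) (t (i + 1))) = D.eval (wordFactor α' (t' i) (t' (i + 1)))) →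
      α ∈ L → α' ∈ L) : IsOmegaRegular L := by
  classical
  have := Fintype.ofFinite T
  let lang (s : T) : Language S := {u | D.eval u = s}
  have hreg (s : T) : (lang s).IsRegular :=
    Language.isRegular_iff.2 ⟨T, inferInstance, ⟨D.step, D.start, {s}⟩, rfl⟩
  let I := {p : T × T // (mulOmegaPow (lang p.1) (lang p.2) ∩ L).Nonempty}
  obtain ⟨n, ⟨e⟩⟩ := Finite.exists_equiv_fin I
  refine ⟨n, fun i => lang (e.symm i).1.1, fun i => lang (e.symm i).1.2,
    fun i => ⟨hreg _, hreg _⟩, Set.Subset.antisymm ?_ ?_⟩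
  · intro α hα
    obtain ⟨t, f, ht, hf⟩ := exists_strictMono_color_eq fun i j => D.eval (wordFactor α i j)
    have hmem : α ∈ mulOmegaPow (lang (D.eval (wordFactor α 0 (t 0)))) (lang f) :=
      ⟨t, ht, rfl, hf⟩
    refine Set.mem_iUnion.2 ⟨e ⟨(D.eval (wordFactor α 0 (t 0)), f), α, hmem, hα⟩, ?_⟩
    simpa only [Equiv.symm_apply_apply] using hmem
  · refine Set.iUnion_subset fun i => ?_
    rintro α' ⟨t', ht', h0', hV'⟩
    obtain ⟨α, ⟨t, ht, h0, hV⟩, hα⟩ := (e.symm i).2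
    exact h α α' t t' ht ht' (h0.trans h0'.symm) (fun j => (hV j).trans (hV' j).symm) hα

namespace DetMuller

variable {S G Q : Type*} (M : DetMuller (S × G) Q)

/-- The automaton that computes, for a finite word over `S`, which pairs of states are joined by
a path along the word, and which by a path along a non-empty prefix of it. -/
def shape : DFA S (Set (Q × Q) × Set (Q × Q)) where
  start := ({p | p.1 = p.2}, ∅)
  step X a := ({p | ∃ q, (p.1, q) ∈ X.1 ∧ ∃ b, p.2 = M.step q (a, b)},
    X.2 ∪ {p | ∃ q, (p.1, q) ∈ X.1 ∧ ∃ b, p.2 = M.step q (a, b)})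
  accept := ∅

variable {M} {α : ℕ → S}

theorem reach_same_time_iff {i : ℕ} {q r : Q} : M.Reach α (i, q) (i, r) ↔ q = r := by
  constructor
  · intro h
    rcases Relation.ReflTransGen.cases_tail h with h | ⟨y, hy, b, hb⟩
    · exact (Prod.ext_iff.1 h).2.symm
    · have := Reach.fst_le hy
      have := (Prod.ext_iff.1 hb).1
      simp only at this
      omega
  · rintro rfl; exact .refl

theorem reach_succ_iff {i j : ℕ} (h : i ≤ j) {q r : Q} : M.Reach α (i, q) (j + 1, r) ↔
    ∃ q', M.Reach α (i, q) (j, q') ∧ ∃ b, r = M.step q' (α j, b) := by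
  constructor
  · intro h'
    rcases Relation.ReflTransGen.cases_tail h' with h' | ⟨⟨j', q'⟩, hy, b, hb⟩
    · have := (Prod.ext_iff.1 h').1
      simp only at this
      omega
    · simp only [Prod.mk.injEq, Nat.add_right_cancel_iff] at hb
      obtain ⟨rfl, rfl⟩ := hb
      exact ⟨q', hy, b, rfl⟩
  · rintro ⟨q', h', b, rfl⟩
    exact h'.tail ⟨b, rfl⟩

theorem eval_shape_wordFactor {i j : ℕ} (h : i ≤ j) :
    M.shape.eval (wordFactor α i j) = ({p | M.Reach α (i, p.1) (j, p.2)},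
      {p | ∃ l, i < l ∧ l ≤ j ∧ M.Reach α (i, p.1) (l, p.2)}) := by
  induction j, h using Nat.le_induction with
  | base =>
    rw [wordFactor_self, DFA.eval_nil]
    refine Prod.ext ?_ ?_
    · ext ⟨q, r⟩; simp [shape, reach_same_time_iff]
    · ext ⟨q, r⟩
      simp only [shape, Set.mem_empty_iff_false, Set.mem_ofPred_eq, false_iff]
      rintro ⟨l, h₁, h₂, -⟩
      omega
  | succ j h ih =>
    rw [wordFactor_succ α h, DFA.eval_append_singleton, ih]
    refine Prod.ext ?_ ?_
    · ext ⟨q, r⟩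
      simp only [shape, Set.mem_ofPred_eq, reach_succ_iff h]
    · ext ⟨q, r⟩
      simp only [shape, Set.mem_ofPred_eq, Set.mem_union, ← reach_succ_iff h]
      constructor
      · rintro (⟨l, h₁, h₂, h₃⟩ | h')
        · exact ⟨l, h₁, h₂.trans (Nat.le_succ _), h₃⟩
        · exact ⟨j + 1, by omega, le_rfl, h'⟩
      · rintro ⟨l, h₁, h₂, h₃⟩
        rcases Nat.lt_or_ge j l with hl | hl
        · obtain rfl : l = j + 1 := by omega
          exact .inr h₃
        · exact .inl ⟨l, h₁, hl, h₃⟩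

/-- Every path passes through all intermediate times. -/
theorem reach_iff_through {i j l : ℕ} (hij : i ≤ j) (hjl : j ≤ l) {q r : Q} :
    M.Reach α (i, q) (l, r) ↔ ∃ q', M.Reach α (i, q) (j, q') ∧ M.Reach α (j, q') (l, r) := by
  refine ⟨fun h => ?_, fun ⟨q', h, h'⟩ => h.trans h'⟩
  induction l, hjl using Nat.le_induction generalizing r with
  | base => exact ⟨r, h, .refl⟩
  | succ l hl ih =>
    obtain ⟨q₁, h₁, b, rfl⟩ := (reach_succ_iff (hij.trans hl)).1 h
    obtain ⟨q', h₂, h₃⟩ := ih h₁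
    exact ⟨q', h₂, h₃.tail ⟨b, rfl⟩⟩

theorem exists_reach_of_le [Nonempty G] (x : ℕ × Q) {j : ℕ} (h : x.1 ≤ j) :
    ∃ r, M.Reach α x (j, r) := by
  induction j, h using Nat.le_induction with
  | base => exact ⟨x.2, .refl⟩
  | succ j h ih =>
    obtain ⟨r, hr⟩ := ih
    obtain ⟨b⟩ := ‹Nonempty G›
    exact ⟨_, hr.tail ⟨b, rfl⟩⟩

/-- Limit sets from the cut points of a factorization, in terms of paths between cut points and
of states visited inside the factors. -/
theorem mem_limitSet_iff {t : ℕ → ℕ} (ht : StrictMono t) {i : ℕ} {q r : Q} :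
    r ∈ M.limitSet α (t i, q) ↔ ∀ N, ∃ l ≥ N, i ≤ l ∧ ∃ q', M.Reach α (t i, q) (t l, q') ∧
      ∃ j, t l < j ∧ j ≤ t (l + 1) ∧ M.Reach α (t l, q') (j, r) := by
  constructor
  · intro h N
    obtain ⟨j, hj, hr⟩ := h (t (max N i) + 1)
    -- the factor in which the time `j` lies
    have hex : ∃ l, j ≤ t (l + 1) := ⟨j, (Nat.le_succ j).trans (ht.id_le _)⟩
    classical
    have hfind := Nat.find_spec hex
    set l := Nat.find hex with hl
    have hmax : max N i ≤ l := by
      by_contra hlt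
      have := ht.monotone (show l + 1 ≤ max N i by omega)
      omega
    have hlt : t l < j := by
      rcases Nat.eq_zero_or_pos l with h0 | h0
      · have : max N i = 0 := by omega
        rw [h0]; rw [this] at hj; omega
      · have := Nat.find_min hex (m := l - 1) (by omega)
        rw [Nat.sub_add_cancel h0] at this
        omega
    have hil : i ≤ l := (le_max_right _ _).trans hmax
    obtain ⟨q', h₁, h₂⟩ := (reach_iff_through (ht.monotone hil) hlt.le).1 hr
    exact ⟨l, (le_max_left _ _).trans hmax, hil, q', h₁, j, hlt, hfind, h₂⟩
  · intro h N
    obtain ⟨l, hl, -, q', h₁, j, hj, -, h₂⟩ := h N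
    exact ⟨j, (hl.trans (ht.id_le l)).trans hj.le, h₁.trans h₂⟩

/-- It suffices to look at the positions at the cut points of a factorization. -/
theorem bottomsAccept_iff_of_strictMono [Nonempty G] {t : ℕ → ℕ} (ht : StrictMono t) :
    M.BottomsAccept α ↔ ∀ i q, M.Reach α (0, M.init) (t i, q) →
      (∀ j ≥ i, ∀ r, M.Reach α (t i, q) (t j, r) →
        M.limitSet α (t j, r) = M.limitSet α (t i, q)) → M.limitSet α (t i, q) ∈ M.acc := by
  constructor
  · intro h i q hr hb
    refine h _ hr fun y hy => hy.limitSet_subset.antisymm ?_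
    have hle : y.1 ≤ t (max i y.1) := (le_max_right _ _).trans (ht.id_le _)
    obtain ⟨r, hr'⟩ := exists_reach_of_le (M := M) (α := α) y hle
    rw [← hb _ (le_max_left _ _) r (hy.trans hr')]
    exact hr'.limitSet_subset
  · intro h x hx hb
    obtain ⟨q, hq⟩ := exists_reach_of_le (M := M) (α := α) x (ht.id_le x.1)
    have hb' := hb.of_reach hq
    rw [← hb _ hq]
    exact h _ q (hx.trans hq) fun j _ r hr => hb' _ hr

/-- The criterion for comeager sections only depends on the shapes of the factors in a
factorization. -/
theorem bottomsAccept_of_shape_eq [Nonempty G] {α' : ℕ → S} {t t' : ℕ → ℕ} (ht : StrictMono t)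
    (ht' : StrictMono t') (h0 : M.shape.eval (wordFactor α 0 (t 0)) =
      M.shape.eval (wordFactor α' 0 (t' 0)))
    (hs : ∀ i, M.shape.eval (wordFactor α (t i) (t (i + 1))) =
      M.shape.eval (wordFactor α' (t' i) (t' (i + 1))))
    (h : M.BottomsAccept α) : M.BottomsAccept α' := by
  rw [eval_shape_wordFactor (Nat.zero_le _), eval_shape_wordFactor (Nat.zero_le _)] at h0
  simp only [eval_shape_wordFactor (ht.monotone (Nat.le_succ _)),
    eval_shape_wordFactor (ht'.monotone (Nat.le_succ _)), Prod.mk.injEq, Set.ext_iff,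
    Set.mem_ofPred_eq, Prod.forall] at h0 hs
  have hcut : ∀ i j, i ≤ j → ∀ q r,
      M.Reach α (t i, q) (t j, r) ↔ M.Reach α' (t' i, q) (t' j, r) := by
    intro i j hij
    induction j, hij using Nat.le_induction with
    | base => intro q r; rw [reach_same_time_iff, reach_same_time_iff]
    | succ j hij ih =>
      intro q r
      rw [reach_iff_through (ht.monotone hij) (ht.monotone (Nat.le_succ j)),
        reach_iff_through (ht'.monotone hij) (ht'.monotone (Nat.le_succ j))]
      simp only [ih, (hs j).1]
  have hinit : ∀ i q, M.Reach α (0, M.init) (t i, q) ↔ M.Reach α' (0, M.init) (t' i, q) := by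
    intro i q
    rw [reach_iff_through (Nat.zero_le _) (ht.monotone (Nat.zero_le i)),
      reach_iff_through (Nat.zero_le _) (ht'.monotone (Nat.zero_le i))]
    simp only [h0.1, hcut 0 i (Nat.zero_le _)]
  have hlim : ∀ i q, M.limitSet α (t i, q) = M.limitSet α' (t' i, q) := by
    intro i q
    ext r
    rw [mem_limitSet_iff ht, mem_limitSet_iff ht']
    refine forall_congr' fun N => exists_congr fun l => and_congr_right fun _ =>
      and_congr_right fun hl => exists_congr fun q' => ?_
    rw [hcut i l hl, (hs l).2]
  rw [bottomsAccept_iff_of_strictMono ht] at h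
  rw [bottomsAccept_iff_of_strictMono ht']
  intro i q hr hb
  rw [← hlim]
  refine h i q ((hinit i q).2 hr) fun j hj r hr' => ?_
  rw [hlim, hlim]
  exact hb j hj r ((hcut i j hj q r).1 hr')

theorem isOmegaRegular_forallStar [Finite G] [Finite Q] :
    IsOmegaRegular (forallStar M.language) := by
  rcases isEmpty_or_nonempty G with hG | hG
  · rw [forallStar_language_of_isEmpty]
    refine ⟨1, fun _ => Set.univ, fun _ => Set.univ, fun _ => ?_, ?_⟩
    · have : Language.IsRegular (Set.univ : Set (List S)) :=
        ⟨Unit, inferInstance, ⟨fun _ _ => (), (), Set.univ⟩, rfl⟩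
      exact ⟨this, this⟩
    · rw [Set.iUnion_const]; exact mulOmegaPow_univ.symm
  · refine isOmegaRegular_of_saturated M.shape _ fun α α' t t' ht ht' h0 hs h => ?_
    rw [mem_forallStar_iff] at h ⊢
    exact bottomsAccept_of_shape_eq ht ht' h0 hs h

end DetMuller

/-! ### Forcing a generic sequence in the Banach–Mazur game -/

namespace DetMuller

variable {S G Q : Type*} (M : DetMuller (S × G) Q) (α : ℕ → S)

/-- The positions from which some path of length `k` leads into `D`. -/
def hits (D : Set (ℕ × Q)) : ℕ → Set (ℕ × Q)
  | 0 => D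
  | k + 1 => {x | ∃ b, (x.1 + 1, M.step x.2 (α x.1, b)) ∈ hits D k}

variable {M α} in
theorem exists_mem_hits_succ {D : Set (ℕ × Q)} {x y : ℕ × Q}
    (h : Relation.TransGen (M.Edge α) x y) (hy : y ∈ D) : ∃ k, x ∈ M.hits α D (k + 1) := by
  induction h using Relation.TransGen.head_induction_on with
  | single h => obtain ⟨b, rfl⟩ := h; exact ⟨0, b, hy⟩
  | head h _ ih =>
    obtain ⟨k, hk⟩ := ih
    obtain ⟨b, rfl⟩ := h
    exact ⟨k + 1, b, hk⟩

open Classical in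
/-- The number of times before `n` at which the predicate `X` was left. -/
noncomputable def handovers (X : ℕ → Prop) (n : ℕ) : ℕ :=
  Nat.count (fun i => X i ∧ ¬ X (i + 1)) n

theorem handovers_succ_of_stay {X : ℕ → Prop} {n : ℕ} (h : X n → X (n + 1)) :
    handovers X (n + 1) = handovers X n := by
  classical
  simp only [handovers, Nat.count_succ]
  rw [if_neg (by tauto), Nat.add_zero]

theorem handovers_succ_of_leave {X : ℕ → Prop} {n : ℕ} (h : X n) (h' : ¬ X (n + 1)) :
    handovers X (n + 1) = handovers X n + 1 := by
  classical
  simp only [handovers, Nat.count_succ]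
  rw [if_pos ⟨h, h'⟩]

theorem handovers_le (X : ℕ → Prop) (n : ℕ) : handovers X n ≤ n := by
  classical exact Nat.count_le _

theorem handovers_congr {X Y : ℕ → Prop} {n : ℕ} (h : ∀ i ≤ n, (X i ↔ Y i)) :
    handovers X n = handovers Y n := by
  induction n with
  | zero => simp [handovers]
  | succ n ih =>
    have ih := ih fun i hi => h i (by omega)
    have h₁ := h n (by omega)
    have h₂ := h (n + 1) le_rfl
    by_cases hX : X n ∧ ¬ X (n + 1)
    · rw [handovers_succ_of_leave hX.1 hX.2, handovers_succ_of_leave (by tauto) (by tauto), ih]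
    · rw [handovers_succ_of_stay (by tauto), handovers_succ_of_stay (by tauto), ih]

/-- If the phases in which `X` holds are all finite and there are infinitely many of them, then
there is a phase for each number of previous phases. -/
theorem exists_handovers_eq {X : ℕ → Prop} (hX : ∃ᶠ n in atTop, X n)
    (hleave : ∀ n, X n → ∃ m ≥ n, X m ∧ ¬ X (m + 1) ∧ handovers X m = handovers X n) (c : ℕ) :
    ∃ n, X n ∧ handovers X n = c := by
  classical
  have next (a : ℕ) : ∃ n, X n ∧ handovers X n = handovers X a := by
    have hex : ∃ n, a ≤ n ∧ X n := by
      obtain ⟨n, hn, h⟩ := frequently_atTop.1 hX a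
      exact ⟨n, hn, h⟩
    have key : ∀ k, a ≤ k → k ≤ Nat.find hex → handovers X k = handovers X a := by
      intro k hk
      induction k, hk using Nat.le_induction with
      | base => exact fun _ => rfl
      | succ k hk ih =>
        intro hlt
        rw [handovers_succ_of_stay fun h => absurd ⟨hk, h⟩ (Nat.find_min hex hlt), ih (by omega)]
    exact ⟨_, (Nat.find_spec hex).2, key _ (Nat.find_spec hex).1 le_rfl⟩
  induction c with
  | zero => simpa [handovers] using next 0
  | succ c ih =>
    obtain ⟨n, hn, hc⟩ := ih
    obtain ⟨m, -, hm, hm', hcm⟩ := hleave n hn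
    obtain ⟨n', hn', hc'⟩ := next (m + 1)
    exact ⟨n', hn', by rw [hc', handovers_succ_of_leave hm hm', hcm, hc]⟩

/-- A positional rule for one phase: approach the set `D` along a shortest path and stop in it, or
stop at once if there is no path to `D`. The value `true` of the first component means that the
phase goes on. -/
theorem exists_rule_toward [Nonempty G] (D : Set (ℕ × Q)) : ∃ τ : ℕ × Q → Bool × G,
    ∀ (X : ℕ → Prop) (ρ : ℕ → Q) (c : ℕ),
      (∀ i, X i → handovers X i = c → ρ (i + 1) = M.step (ρ i) (α i, (τ (i, ρ i)).2) ∧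
        (X (i + 1) ↔ (τ (i, ρ i)).1 = true)) →
      ∀ n, X n → handovers X n = c → ∃ m ≥ n, X m ∧ ¬ X (m + 1) ∧ handovers X m = c ∧
        ((m + 1, ρ (m + 1)) ∈ D ∨ ∀ y, Relation.TransGen (M.Edge α) (n, ρ n) y → y ∉ D) := by
  classical
  obtain ⟨b₀⟩ := ‹Nonempty G›
  have hex (x : ℕ × Q) : ∃ r : Bool × G, (∀ h : ∃ k, x ∈ M.hits α D (k + 1),
      r.1 = decide (Nat.find h ≠ 0) ∧
        (x.1 + 1, M.step x.2 (α x.1, r.2)) ∈ M.hits α D (Nat.find h)) ∧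
      ((¬ ∃ k, x ∈ M.hits α D (k + 1)) → r.1 = false) := by
    by_cases h : ∃ k, x ∈ M.hits α D (k + 1)
    · obtain ⟨b, hb⟩ := Nat.find_spec h
      exact ⟨(decide (Nat.find h ≠ 0), b), fun _ => ⟨rfl, hb⟩, fun h' => absurd h h'⟩
    · exact ⟨(false, b₀), fun h' => absurd h' h, fun _ => rfl⟩
  choose τ hpos hneg using hex
  refine ⟨τ, fun X ρ c hτ => ?_⟩
  -- induction on the distance to `D`
  have key : ∀ k n, X n → handovers X n = c → ∀ h : ∃ k, (n, ρ n) ∈ M.hits α D (k + 1),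
      Nat.find h ≤ k → ∃ m ≥ n, X m ∧ ¬ X (m + 1) ∧ handovers X m = c ∧
        (m + 1, ρ (m + 1)) ∈ D := by
    intro k
    induction k with
    | zero =>
      intro n hn hc h hk
      obtain ⟨h₁, h₂⟩ := hτ n hn hc
      obtain ⟨h₃, hspec⟩ := hpos _ h
      have h0 : Nat.find h = 0 := by omega
      rw [h0] at h₃ hspec
      refine ⟨n, le_rfl, hn, by simp [h₂, h₃], hc, ?_⟩
      rw [h₁]
      exact hspec
    | succ k ih =>
      intro n hn hc h hk
      by_cases h0 : Nat.find h ≤ k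
      · exact ih n hn hc h h0
      obtain ⟨h₁, h₂⟩ := hτ n hn hc
      obtain ⟨h₃, hspec⟩ := hpos _ h
      have hk' : Nat.find h = k + 1 := by omega
      rw [hk'] at h₃ hspec
      have hX : X (n + 1) := by simp [h₂, h₃]
      have hmem : (n + 1, ρ (n + 1)) ∈ M.hits α D (k + 1) := by
        rw [h₁]
        exact hspec
      obtain ⟨m, hm, h'⟩ := ih (n + 1) hX
        ((handovers_succ_of_stay fun _ => hX).trans hc) ⟨k, hmem⟩ (Nat.find_le hmem)
      exact ⟨m, by omega, h'⟩
  intro n hn hc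
  by_cases h : ∃ k, (n, ρ n) ∈ M.hits α D (k + 1)
  · obtain ⟨m, hm, h₁, h₂, h₃, h₄⟩ := key _ n hn hc h le_rfl
    exact ⟨m, hm, h₁, h₂, h₃, .inl h₄⟩
  · refine ⟨n, le_rfl, hn, ?_, hc, .inr fun y hy hD => h (exists_mem_hits_succ hy hD)⟩
    simp [(hτ n hn hc).2, hneg _ h]

/-- A rule for all phases, with the target `D c` in the phase after `c` hand-overs. -/
theorem exists_rule [Nonempty G] (D : ℕ → Set (ℕ × Q)) : ∃ τ : ℕ → ℕ × Q → Bool × G,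
    ∀ (X : ℕ → Prop) (ρ : ℕ → Q),
      (∀ i, X i → ρ (i + 1) = M.step (ρ i) (α i, (τ (handovers X i) (i, ρ i)).2) ∧
        (X (i + 1) ↔ (τ (handovers X i) (i, ρ i)).1 = true)) →
      ∀ n, X n → ∃ m ≥ n, X m ∧ ¬ X (m + 1) ∧ handovers X m = handovers X n ∧
        ((m + 1, ρ (m + 1)) ∈ D (handovers X n) ∨
          ∀ y, Relation.TransGen (M.Edge α) (n, ρ n) y → y ∉ D (handovers X n)) := by
  choose τ hτ using fun c => M.exists_rule_toward α (D c)
  refine ⟨τ, fun X ρ h n hn => hτ _ X ρ _ (fun i hi hc => ?_) n hn rfl⟩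
  have := h i hi
  rwa [hc] at this

variable {M α}

theorem generic_of_forced {X : ℕ → Prop} {ρ : ℕ → Q} {D : ℕ → Set (ℕ × Q)}
    (hD : ∀ d N, ∃ c ≥ N, D c = M.target α d) (hX : ∃ᶠ n in atTop, X n)
    (h : ∀ n, X n → ∃ m ≥ n, X m ∧ ¬ X (m + 1) ∧ handovers X m = handovers X n ∧
      ((m + 1, ρ (m + 1)) ∈ D (handovers X n) ∨
        ∀ y, Relation.TransGen (M.Edge α) (n, ρ n) y → y ∉ D (handovers X n))) :
    M.Generic α ρ := by
  intro d N
  obtain ⟨c, hc, hDc⟩ := hD d N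
  obtain ⟨n, hn, rfl⟩ := exists_handovers_eq hX
    (fun n hn => (h n hn).imp fun m hm => ⟨hm.1, hm.2.1, hm.2.2.1, hm.2.2.2.1⟩) c
  have hle := handovers_le X n
  obtain ⟨m, hm, -, -, -, h' | h'⟩ := h n hn
  · exact ⟨m + 1, by omega, .inl (hDc ▸ h')⟩
  · exact ⟨n, by omega, .inr (hDc ▸ h')⟩

/-- An enumeration of the targets in which each of them recurs. -/
theorem exists_enum_target [Finite Q] [Nonempty Q] :
    ∃ D : ℕ → Set (ℕ × Q), ∀ d N, ∃ c ≥ N, D c = M.target α d := by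
  obtain ⟨f, hf⟩ := exists_surjective_nat (Q ⊕ Q)
  refine ⟨fun c => M.target α (f c.unpair.1), fun d N => ?_⟩
  obtain ⟨i, rfl⟩ := hf d
  exact ⟨Nat.pair i N, Nat.right_le_pair i N, by simp⟩

end DetMuller

/-! ### Plays of the acceptance game -/

namespace DL

variable {X : Type*}

/-- The atoms of an expression. -/
def leaves : DL X → Set X
  | atom x => {x}
  | and e₁ e₂ => leaves e₁ ∪ leaves e₂
  | or e₁ e₂ => leaves e₁ ∪ leaves e₂

/-- Disjunction for `true`, conjunction for `false`. -/
def bin : Bool → DL X → DL X → DL X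
  | true => or
  | false => and

/-- Expressions in which only one of the connectives occurs: disjunction for `true`, conjunction
for `false`. -/
inductive IsPure (o : Bool) : DL X → Prop
  | atom (x : X) : IsPure o (.atom x)
  | bin {e₁ e₂ : DL X} (h₁ : IsPure o e₁) (h₂ : IsPure o e₂) : IsPure o (bin o e₁ e₂)

theorem leaves_bin (o : Bool) (e₁ e₂ : DL X) :
    (bin o e₁ e₂).leaves = e₁.leaves ∪ e₂.leaves := by cases o <;> rfl

end DL

namespace AltMuller

variable {A P : Type*} {B : AltMuller A P} {w : ℕ → A} {π : ℕ → Conf P}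

/-- A measure of progress in the game: forms at time `n` come directly before states at time
`n`. -/
def Conf.level : Conf P → ℕ
  | .state n _ => 2 * n + 1
  | .form n _ => 2 * n

theorem Move.level_le {x y : Conf P} (h : B.Move w x y) : x.level ≤ y.level := by
  cases h <;> simp only [Conf.level] <;> omega

theorem IsPlay.level_mono (h : B.IsPlay w π) : Monotone fun i => (π i).level :=
  monotone_nat_of_le_succ fun i => (h.2 i).level_le

theorem IsPlay.eq_form_of_state (h : B.IsPlay w π) {i n : ℕ} {q : P} (hi : π i = .state n q) :
    π (i + 1) = .form (n + 1) (B.step q (w n)) := by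
  have hm := h.2 i
  rw [hi] at hm
  generalize π (i + 1) = y at hm
  cases hm
  rfl

/-- The configuration with a state at time `n` occurs only once in a play. -/
theorem IsPlay.state_unique (h : B.IsPlay w π) {i j n : ℕ} {q q' : P}
    (hi : π i = .state n q) (hj : π j = .state n q') : q = q' := by
  have key : ∀ {i j : ℕ} {q q' : P}, π i = .state n q → π j = .state n q' → ¬ i < j := by
    intro i j q q' hi hj hlt
    have := h.level_mono (show i + 1 ≤ j from hlt)
    simp only [h.eq_form_of_state hi, hj, Conf.level] at this
    omega
  obtain rfl : i = j := le_antisymm (not_lt.1 (key hj hi)) (not_lt.1 (key hi hj))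
  rw [hi] at hj
  cases hj
  rfl

/-- From an expression, a play gets to one of its atoms. -/
theorem IsPlay.exists_state_of_form (h : B.IsPlay w π) {i n : ℕ} {e : DL P}
    (hi : π i = .form n e) : ∃ j q, q ∈ e.leaves ∧ π j = .state n q := by
  induction e generalizing i with
  | atom q =>
    have hm := h.2 i
    rw [hi] at hm
    generalize hy : π (i + 1) = y at hm
    cases hm
    exact ⟨i + 1, q, rfl, hy⟩
  | and e₁ e₂ ih₁ ih₂ =>
    have hm := h.2 i
    rw [hi] at hm
    generalize hy : π (i + 1) = y at hm
    cases hm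
    · obtain ⟨j, q, hq, hj⟩ := ih₁ hy; exact ⟨j, q, .inl hq, hj⟩
    · obtain ⟨j, q, hq, hj⟩ := ih₂ hy; exact ⟨j, q, .inr hq, hj⟩
  | or e₁ e₂ ih₁ ih₂ =>
    have hm := h.2 i
    rw [hi] at hm
    generalize hy : π (i + 1) = y at hm
    cases hm
    · obtain ⟨j, q, hq, hj⟩ := ih₁ hy; exact ⟨j, q, .inl hq, hj⟩
    · obtain ⟨j, q, hq, hj⟩ := ih₂ hy; exact ⟨j, q, .inr hq, hj⟩

/-- The state `s n` is the one that the play `π` has at time `n`, in its configuration with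
index `T n`. -/
def IsTrace (π : ℕ → Conf P) (T : ℕ → ℕ) (s : ℕ → P) : Prop :=
  ∀ n, π (T n) = .state n (s n)

theorem IsPlay.exists_isTrace (h : B.IsPlay w π) : ∃ T s, IsTrace π T s := by
  have : ∀ n, ∃ i q, π i = .state n q := by
    intro n
    induction n with
    | zero => exact ⟨0, _, h.1⟩
    | succ n ih =>
      obtain ⟨i, q, hi⟩ := ih
      obtain ⟨j, q, -, hj⟩ := h.exists_state_of_form (h.eq_form_of_state hi)
      exact ⟨j, q, hj⟩
  choose T s hs using this
  exact ⟨T, s, hs⟩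

theorem IsTrace.zero_eq {T : ℕ → ℕ} {s : ℕ → P} (hs : IsTrace π T s) (h : B.IsPlay w π) :
    s 0 = B.init := h.state_unique (hs 0) h.1

theorem IsTrace.succ_mem_leaves {T : ℕ → ℕ} {s : ℕ → P} (hs : IsTrace π T s) (h : B.IsPlay w π)
    (n : ℕ) : s (n + 1) ∈ (B.step (s n) (w n)).leaves := by
  obtain ⟨j, q, hq, hj⟩ := h.exists_state_of_form (h.eq_form_of_state (hs n))
  rwa [h.state_unique (hs (n + 1)) hj]

theorem IsTrace.strictMono {T : ℕ → ℕ} {s : ℕ → P} (hs : IsTrace π T s) (h : B.IsPlay w π) :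
    StrictMono T := by
  refine strictMono_nat_of_lt_succ fun n => ?_
  by_contra hle
  have := h.level_mono (not_lt.1 hle)
  simp only [hs n, hs (n + 1), Conf.level] at this
  omega

theorem IsTrace.playInf_eq {T : ℕ → ℕ} {s : ℕ → P} (hs : IsTrace π T s) (h : B.IsPlay w π) :
    playInf π = infOcc s := by
  ext q
  constructor
  · refine fun hq => frequently_atTop.2 fun N => ?_
    obtain ⟨i, hi, n, hn⟩ := frequently_atTop.1 hq (T N)
    refine ⟨n, ?_, h.state_unique (hs n) hn⟩
    have := h.level_mono hi
    simp only [hs N, hn, Conf.level] at this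
    omega
  · refine fun hq => frequently_atTop.2 fun N => ?_
    obtain ⟨n, hn, rfl⟩ := frequently_atTop.1 hq N
    exact ⟨T n, hn.trans ((hs.strictMono h).id_le n), n, hs n⟩

open Classical in
/-- The state at time `j` according to a history of a play, with `d` as default. -/
noncomputable def stateAt (d : P) (l : List (Conf P)) (j : ℕ) : P :=
  if h : ∃ q, Conf.state j q ∈ l then h.choose else d

theorem IsTrace.stateAt_eq {T : ℕ → ℕ} {s : ℕ → P} (hs : IsTrace π T s) (h : B.IsPlay w π)
    (d : P) {i j : ℕ} (hij : T j ≤ i) : stateAt d ((List.range (i + 1)).map π) j = s j := by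
  have hex : ∃ q, Conf.state j q ∈ (List.range (i + 1)).map π :=
    ⟨s j, List.mem_map.2 ⟨T j, List.mem_range.2 (by omega), hs j⟩⟩
  rw [stateAt, dif_pos hex]
  obtain ⟨k, -, hk⟩ := List.mem_map.1 hex.choose_spec
  exact h.state_unique hk (hs j)

/-- A rule that picks the next state is local if it only depends on the past. -/
def IsLocal (g : (ℕ → P) → ℕ → P) : Prop :=
  ∀ s s' n, (∀ j ≤ n, s j = s' j) → g s n = g s' n

open Classical in
/-- In the play `π` the owner of the connective `o` descends towards the atoms chosen by the
rule `g`. -/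
def Obeys (o : Bool) (d : P) (g : (ℕ → P) → ℕ → P) (π : ℕ → Conf P) : Prop :=
  ∀ i n e₁ e₂, π i = .form (n + 1) (DL.bin o e₁ e₂) → π (i + 1) = .form (n + 1)
    (if g (stateAt d ((List.range (i + 1)).map π)) n ∈ e₁.leaves then e₁ else e₂)

theorem IsTrace.succ_eq_of_obeys {T : ℕ → ℕ} {s : ℕ → P} (hs : IsTrace π T s)
    (h : B.IsPlay w π) {o : Bool} {d : P} {g : (ℕ → P) → ℕ → P} (hg : IsLocal g)
    (hobeys : Obeys o d g π) {n : ℕ} (hp : (B.step (s n) (w n)).IsPure o)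
    (hmem : g s n ∈ (B.step (s n) (w n)).leaves) : s (n + 1) = g s n := by
  classical
  have key : ∀ (e : DL P), e.IsPure o → g s n ∈ e.leaves → ∀ i, T n ≤ i →
      π i = .form (n + 1) e → ∃ j, π j = .state (n + 1) (g s n) := by
    intro e he
    induction he with
    | atom q =>
      intro hq i _ hi
      have hm := h.2 i
      rw [hi] at hm
      generalize hy : π (i + 1) = y at hm
      cases hm
      obtain rfl : g s n = q := hq
      exact ⟨i + 1, hy⟩
    | @bin e₁ e₂ _ _ ih₁ ih₂ =>
      intro hq i hT hi
      have hm := hobeys i n e₁ e₂ hi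
      rw [hg _ s n fun j hj => hs.stateAt_eq h d
        (((hs.strictMono h).monotone hj).trans hT)] at hm
      split_ifs at hm with hc
      · exact ih₁ hc (i + 1) (by omega) hm
      · rw [DL.leaves_bin] at hq
        exact ih₂ (hq.resolve_left hc) (i + 1) (by omega) hm
  obtain ⟨j, hj⟩ := key _ hp hmem (T n + 1) (Nat.le_succ _) (h.eq_form_of_state (hs n))
  exact h.state_unique (hs (n + 1)) hj

/-- The existential player can obey any rule. -/
theorem exists_strategy_obeys (d : P) (g : (ℕ → P) → ℕ → P) :
    ∃ σ : List (Conf P) → Bool, ∀ π : ℕ → Conf P, Consistent σ π → Obeys true d g π := by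
  classical
  refine ⟨fun l => match l.getLast? with
    | some (.form (n + 1) (.or e₁ _)) => decide (g (stateAt d l) n ∈ e₁.leaves)
    | _ => true, fun π hπ i n e₁ e₂ hi => ?_⟩
  have := hπ i (n + 1) e₁ e₂ hi
  rw [this]
  have hl : ((List.range (i + 1)).map π).getLast? = some (.form (n + 1) (.or e₁ e₂)) := by
    rw [List.range_succ, List.map_append, List.map_singleton, List.getLast?_concat, hi]
    rfl
  simp only [hl, decide_eq_true_eq]

/-- Whatever the strategy of the existential player, the universal player can obey any rule. -/
theorem exists_play_obeys (B : AltMuller A P) (w : ℕ → A) (σ : List (Conf P) → Bool) (d : P)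
    (g : (ℕ → P) → ℕ → P) :
    ∃ π : ℕ → Conf P, B.IsPlay w π ∧ Consistent σ π ∧ Obeys false d g π := by
  classical
  -- the move in the configuration `x`, if the history up to and including `x` is `l`
  let next (l : List (Conf P)) (x : Conf P) : Conf P := match x with
    | .state n q => .form (n + 1) (B.step q (w n))
    | .form n (.atom q) => .state n q
    | .form n (.or e₁ e₂) => .form n (if σ l = true then e₁ else e₂)
    | .form n (.and e₁ e₂) => .form n (if g (stateAt d l) (n - 1) ∈ e₁.leaves then e₁ else e₂)
  let it (i : ℕ) : Conf P × List (Conf P) :=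
    (fun p => (next (p.2 ++ [p.1]) p.1, p.2 ++ [p.1]))^[i] (.state 0 B.init, [])
  let π (i : ℕ) : Conf P := (it i).1
  have hit (i : ℕ) : it (i + 1) = (next ((it i).2 ++ [(it i).1]) (it i).1,
      (it i).2 ++ [(it i).1]) := Function.iterate_succ_apply' _ _ _
  have hhist (i : ℕ) : (it i).2 = (List.range i).map π := by
    induction i with
    | zero => rfl
    | succ i ih => rw [hit, ih, List.range_succ, List.map_append, List.map_singleton]
  have hπ (i : ℕ) : π (i + 1) = next ((List.range (i + 1)).map π) (π i) := by
    have : π (i + 1) = next ((it i).2 ++ [(it i).1]) (it i).1 := congrArg Prod.fst (hit i)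
    rw [this, hhist, List.range_succ, List.map_append, List.map_singleton]
  refine ⟨π, ⟨rfl, fun i => ?_⟩, fun i n e₁ e₂ hi => ?_, fun i n e₁ e₂ hi => ?_⟩
  · rw [hπ]
    generalize (List.range (i + 1)).map π = l
    generalize π i = x
    match x with
    | .state n q => exact .read n q
    | .form n (.atom q) => exact .atom n q
    | .form n (.or e₁ e₂) =>
      by_cases h : σ l = true
      · simp only [next, h, if_true]; exact .orLeft n e₁ e₂
      · simp only [next, h]; exact .orRight n e₁ e₂
    | .form n (.and e₁ e₂) =>
      by_cases h : g (stateAt d l) (n - 1) ∈ e₁.leaves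
      · simp only [next, h, if_true]; exact .andLeft n e₁ e₂
      · simp only [next, h, if_false]; exact .andRight n e₁ e₂
  · rw [hπ, hi]
  · rw [hπ, hi]; rfl

end AltMuller

/-! ### The alternating automaton of the Banach–Mazur game -/

/-- The alternating automaton `B` plays the Banach–Mazur game of `M`: its states are states of `M`
together with a phase, `true` if the existential player moves. The player who moves chooses a letter
of `G` and the next phase. A player who never passes the move on loses, and otherwise the
acceptance condition of `M` decides. -/
structure IsBanachMazur {S G Q P : Type*} (M : DetMuller (S × G) Q) (B : AltMuller S P)
    (proj : P → Q) (ex : P → Bool) : Prop where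
  proj_init : proj B.init = M.init
  ex_init : ex B.init = false
  exists_state : ∀ c q, ∃ p, ex p = c ∧ proj p = q
  isPure : ∀ p a, (B.step p a).IsPure (ex p)
  mem_leaves : ∀ p a p', p' ∈ (B.step p a).leaves ↔ ∃ b, proj p' = M.step (proj p) (a, b)
  mem_acc : ∀ F, F ∈ B.acc ↔
    ((∃ p ∈ F, ex p = true) → (∃ p ∈ F, ex p = false) ∧ proj '' F ∈ M.acc)

theorem exists_mem_infOcc {P : Type*} [Finite P] (s : ℕ → P) (C : P → Prop) :
    (∃ p ∈ infOcc s, C p) ↔ ∃ᶠ n in atTop, C (s n) := by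
  constructor
  · rintro ⟨p, hp, hC⟩
    exact Frequently.mono hp fun n hn => hn ▸ hC
  · intro h
    obtain ⟨p, hp⟩ := frequently_exists.1 (h.mono fun n hn => (⟨s n, rfl, hn⟩ :
      ∃ p, s n = p ∧ C p))
    obtain ⟨n, -, hC⟩ := hp.exists
    exact ⟨p, hp.mono fun _ h => h.1, hC⟩

theorem image_infOcc {P Q : Type*} [Finite P] (s : ℕ → P) (f : P → Q) :
    f '' infOcc s = infOcc fun n => f (s n) :=
  Set.ext fun q => exists_mem_infOcc s fun p => f p = q

namespace IsBanachMazur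

variable {S G Q P : Type*} {M : DetMuller (S × G) Q} {B : AltMuller S P} {proj : P → Q}
  {ex : P → Bool} {α : ℕ → S}

open DetMuller AltMuller

/-- The owner of the phase `o` has a rule that, in the phase after `c` hand-overs, leads to the
target `D c` whenever that is possible. -/
theorem exists_local_rule [Nonempty G] (hB : IsBanachMazur M B proj ex) (o : Bool)
    (D : ℕ → Set (ℕ × Q)) : ∃ g : (ℕ → P) → ℕ → P, IsLocal g ∧
      (∀ s n, g s n ∈ (B.step (s n) (α n)).leaves) ∧
      ∀ s : ℕ → P, (∀ n, ex (s n) = o → s (n + 1) = g s n) → ∀ n, ex (s n) = o →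
        ∃ m ≥ n, ex (s m) = o ∧ ¬ ex (s (m + 1)) = o ∧
          handovers (fun i => ex (s i) = o) m = handovers (fun i => ex (s i) = o) n ∧
          ((m + 1, proj (s (m + 1))) ∈ D (handovers (fun i => ex (s i) = o) n) ∨
            ∀ y, Relation.TransGen (M.Edge α) (n, proj (s n)) y →
              y ∉ D (handovers (fun i => ex (s i) = o) n)) := by
  obtain ⟨τ, hτ⟩ := M.exists_rule α D
  choose pk hex hproj using hB.exists_state
  let mv (s : ℕ → P) (n : ℕ) : Bool × G :=
    τ (handovers (fun i => ex (s i) = o) n) (n, proj (s n))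
  refine ⟨fun s n => pk (if (mv s n).1 = true then o else !o)
    (M.step (proj (s n)) (α n, (mv s n).2)), ?_, ?_, ?_⟩
  · intro s s' n h
    have : mv s n = mv s' n := by
      simp only [mv]
      rw [handovers_congr fun i hi => by rw [h i hi], h n le_rfl]
    simp only [this, h n le_rfl]
  · intro s n
    exact (hB.mem_leaves _ _ _).2 ⟨(mv s n).2, hproj _ _⟩
  · intro s hs
    refine hτ (fun i => ex (s i) = o) (fun i => proj (s i)) fun i hi => ?_
    rw [hs i hi, hproj, hex]
    refine ⟨rfl, ?_⟩
    by_cases h : (mv s i).1 = true <;> simp [h] <;> simpa [mv] using h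

/-- The automaton of the Banach–Mazur game accepts `α` if and only if the section over `α` is
comeager: in either case, the player who should win forces a generic sequence. -/
theorem language_eq [Finite Q] [Finite G] [Nonempty G] [Finite P]
    (hB : IsBanachMazur M B proj ex) : B.language = forallStar M.language := by
  have : Nonempty Q := ⟨M.init⟩
  ext α
  rw [mem_forallStar_iff]
  obtain ⟨D, hD⟩ := exists_enum_target (M := M) (α := α)
  have hpath {π T s} (hs : IsTrace π T s) (h : B.IsPlay α π) (n : ℕ) :
      M.Edge α (n, proj (s n)) (n + 1, proj (s (n + 1))) := by
    obtain ⟨b, hb⟩ := (hB.mem_leaves _ _ _).1 (hs.succ_mem_leaves h n)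
    exact ⟨b, by rw [hb]⟩
  constructor
  · rintro ⟨σ, hσ⟩
    by_contra hC
    simp only [BottomsAccept, not_forall] at hC
    obtain ⟨x, hx, hb, hacc⟩ := hC
    -- the first target of the universal player is the rejecting bottom position
    obtain ⟨g, hg, hleaves, hforce⟩ := hB.exists_local_rule (α := α) false
      fun c => Nat.casesOn c {x} D
    obtain ⟨π, hπ, hcons, hobeys⟩ := exists_play_obeys B α σ B.init g
    obtain ⟨T, s, hs⟩ := hπ.exists_isTrace
    have hforce := hforce s fun n hn =>
      hs.succ_eq_of_obeys hπ hg hobeys (hn ▸ hB.isPure _ _) (hleaves s n)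
    have hwin := hσ π hπ hcons
    rw [hs.playInf_eq hπ, hB.mem_acc, exists_mem_infOcc, exists_mem_infOcc, image_infOcc] at hwin
    -- the universal player never keeps the move forever
    have hboth : ∃ᶠ n in atTop, ex (s n) = true := by
      by_contra hne
      rw [not_frequently] at hne
      refine hne.exists_forall_of_atTop.elim fun a ha => ?_
      obtain ⟨m, hm, -, h', -⟩ := hforce a (by simpa using ha a le_rfl)
      exact h' (by simpa using ha (m + 1) (by omega))
    obtain ⟨hfalse, hM⟩ := hwin hboth
    have hgen : M.Generic α fun n => proj (s n) := by
      refine generic_of_forced (fun d N => ?_) hfalse hforce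
      obtain ⟨c, hc, h⟩ := hD d N
      exact ⟨c + 1, by omega, h⟩
    have hinit : proj (s 0) = M.init := by rw [hs.zero_eq hπ, hB.proj_init]
    have hon : ∃ m, (m, proj (s m)) = x := by
      rcases Relation.reflTransGen_iff_eq_or_transGen.1 hx with rfl | hx
      · exact ⟨0, by rw [hinit]⟩
      · obtain ⟨m, -, -, -, -, h | h⟩ := hforce 0 (by rw [hs.zero_eq hπ, hB.ex_init])
        · exact ⟨m + 1, by simpa [handovers] using h⟩
        · rw [hinit] at h
          exact absurd (by simp [handovers]) (h x hx)
    obtain ⟨m, rfl⟩ := hon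
    rw [hgen.infOcc_eq (hpath hs hπ) hb] at hM
    exact hacc hM
  · intro hC
    obtain ⟨g, hg, hleaves, hforce⟩ := hB.exists_local_rule (α := α) true D
    obtain ⟨σ, hσ⟩ := exists_strategy_obeys B.init g
    refine ⟨σ, fun π hπ hcons => ?_⟩
    obtain ⟨T, s, hs⟩ := hπ.exists_isTrace
    have hforce := hforce s fun n hn =>
      hs.succ_eq_of_obeys hπ hg (hσ π hcons) (hn ▸ hB.isPure _ _) (hleaves s n)
    rw [hs.playInf_eq hπ, hB.mem_acc, exists_mem_infOcc, exists_mem_infOcc, image_infOcc]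
    intro htrue
    constructor
    · by_contra hne
      rw [not_frequently] at hne
      refine hne.exists_forall_of_atTop.elim fun a ha => ?_
      obtain ⟨m, hm, -, h', -⟩ := hforce a (by simpa using ha a le_rfl)
      exact h' (by simpa using ha (m + 1) (by omega))
    · have hgen : M.Generic α fun n => proj (s n) := generic_of_forced hD htrue hforce
      obtain ⟨m, hm⟩ := hgen.exists_isBottom (hpath hs hπ)
      rw [hgen.infOcc_eq (hpath hs hπ) hm]
      refine hC _ ?_ hm
      rw [← hB.proj_init, ← hs.zero_eq hπ]
      exact reach_of_path (hpath hs hπ) (Nat.zero_le m)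

end IsBanachMazur

/-! ### Expressions and formulas of the alternating automaton -/

namespace DL

variable {X : Type*}

/-- The disjunction (`o = true`) or conjunction (`o = false`) of the atoms in `l` and of `y`. -/
def chain (o : Bool) (l : List X) (y : X) : DL X :=
  l.foldr (fun x e => bin o (atom x) e) (atom y)

theorem isPure_chain (o : Bool) (l : List X) (y : X) : (chain o l y).IsPure o := by
  induction l with
  | nil => exact .atom y
  | cons x l ih => exact .bin (.atom x) ih

theorem mem_leaves_chain {o : Bool} {l : List X} {x y : X} :
    x ∈ (chain o l y).leaves ↔ x ∈ l ∨ x = y := by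
  induction l with
  | nil => simp [chain, leaves]
  | cons z l ih =>
    have : chain o (z :: l) y = bin o (atom z) (chain o l y) := rfl
    rw [this, leaves_bin, Set.mem_union, ih, List.mem_cons, or_assoc]
    rfl

theorem size_chain (o : Bool) (l : List X) (y : X) : (chain o l y).size = 2 * l.length + 1 := by
  induction l with
  | nil => rfl
  | cons z l ih =>
    have : (chain o (z :: l) y).size = 1 + (chain o l y).size + 1 := by cases o <;> rfl
    rw [this, ih, List.length_cons]
    ring

theorem code_chain {n : ℕ} (o : Bool) (l : List (Fin n)) (y : Fin n) :
    (chain o l y).code = l.flatMap (fun x : Fin n => [o.toNat, (x : ℕ) + 2]) ++ [(y : ℕ) + 2] := by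
  induction l with
  | nil => rfl
  | cons z l ih =>
    have : (chain o (z :: l) y).code = o.toNat :: ([(z : ℕ) + 2] ++ (chain o l y).code) := by
      cases o <;> rfl
    rw [this, ih]
    simp

end DL

namespace Fin

variable {n : ℕ}

/-- The state `q` with the phase `c`: the states with phase `false` are followed by those with
phase `true`. -/
def withPhase : Bool → Fin n → Fin (n + n)
  | false => Fin.castAdd n
  | true => Fin.natAdd n

/-- The state of the given automaton that underlies a state with a phase. -/
def dropPhase : Fin (n + n) → Fin n :=
  Fin.addCases id id

/-- The phase of a state. -/
def phase : Fin (n + n) → Bool :=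
  Fin.addCases (fun _ => false) fun _ => true

@[simp] theorem dropPhase_withPhase (c : Bool) (q : Fin n) : (withPhase c q).dropPhase = q := by
  cases c
  · exact Fin.addCases_left _
  · exact Fin.addCases_right _

@[simp] theorem phase_withPhase (c : Bool) (q : Fin n) : (withPhase c q).phase = c := by
  cases c
  · exact Fin.addCases_left _
  · exact Fin.addCases_right _

theorem exists_eq_withPhase (p : Fin (n + n)) : ∃ c q, p = withPhase c q := by
  induction p using Fin.addCases with
  | left q => exact ⟨false, q, rfl⟩
  | right q => exact ⟨true, q, rfl⟩

@[simp] theorem val_withPhase_false (q : Fin n) : (withPhase false q : ℕ) = q := rfl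

@[simp] theorem val_withPhase_true (q : Fin n) : (withPhase true q : ℕ) = n + q := rfl

end Fin

namespace AccFormula

/-- The formula which says that some state of the list occurs. -/
def anyOf {Q : Type*} (l : List Q) : AccFormula Q :=
  l.foldr (fun q φ => or (atom q) φ) fls

theorem mem_family_anyOf {Q : Type*} {l : List Q} {F : Set Q} :
    F ∈ (anyOf l).family ↔ ∃ q ∈ l, q ∈ F := by
  induction l with
  | nil => simp [anyOf, family]
  | cons q l ih =>
    have : (anyOf (q :: l)).family = {F | q ∈ F} ∪ (anyOf l).family := rfl
    simp [this, ih]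

theorem size_anyOf {Q : Type*} (l : List Q) : (anyOf l).size = 2 * l.length + 1 := by
  induction l with
  | nil => rfl
  | cons q l ih =>
    have : (anyOf (q :: l)).size = 1 + (anyOf l).size + 1 := rfl
    rw [this, ih, List.length_cons]
    ring

theorem code_anyOf {n : ℕ} (l : List (Fin n)) :
    (anyOf l).code = l.flatMap (fun q : Fin n => [3, (q : ℕ) + 4]) ++ [0] := by
  induction l with
  | nil => rfl
  | cons q l ih =>
    have : (anyOf (q :: l)).code = 3 :: ([(q : ℕ) + 4] ++ (anyOf l).code) := rfl
    rw [this, ih]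
    simp

/-- The formula over the states with phases which says that the set of their underlying states
satisfies the given formula. -/
def bothPhases {n : ℕ} : AccFormula (Fin n) → AccFormula (Fin (n + n))
  | fls => fls
  | atom q => or (atom (q.withPhase false)) (atom (q.withPhase true))
  | neg φ => neg (bothPhases φ)
  | and φ ψ => and (bothPhases φ) (bothPhases ψ)
  | or φ ψ => or (bothPhases φ) (bothPhases ψ)

theorem size_bothPhases_le {n : ℕ} (φ : AccFormula (Fin n)) : φ.bothPhases.size ≤ 3 * φ.size := by
  induction φ <;> simp only [bothPhases, size] <;> omega

theorem code_bothPhases {n : ℕ} (φ : AccFormula (Fin n)) :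
    φ.bothPhases.code = φ.code.flatMap fun x => if x < 4 then [x] else [3, x, n + x] := by
  induction φ <;> simp_all [bothPhases, code, ← add_assoc]

end AccFormula

theorem AccFormula.mem_family_bothPhases {n : ℕ} (φ : AccFormula (Fin n)) (F : Set (Fin (n + n))) :
    F ∈ φ.bothPhases.family ↔ Fin.dropPhase '' F ∈ φ.family := by
  induction φ with
  | fls => simp [bothPhases, family]
  | atom q =>
    simp only [bothPhases, family, Set.mem_union, Set.mem_ofPred_eq, Set.mem_image]
    constructor
    · rintro (h | h)
      · exact ⟨_, h, Fin.dropPhase_withPhase _ q⟩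
      · exact ⟨_, h, Fin.dropPhase_withPhase _ q⟩
    · rintro ⟨p, hp, rfl⟩
      obtain ⟨c, q, rfl⟩ := p.exists_eq_withPhase
      rw [Fin.dropPhase_withPhase]
      cases c
      · exact .inl hp
      · exact .inr hp
  | neg φ ih => simp [bothPhases, family, ih]
  | and φ ψ ih₁ ih₂ => simp [bothPhases, family, ih₁, ih₂]
  | or φ ψ ih₁ ih₂ => simp [bothPhases, family, ih₁, ih₂]

namespace DetMuller

variable {k m n : ℕ} (M : DetMuller (Fin k × Fin m) (Fin n)) (φ : AccFormula (Fin n))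

/-- A successor of the state `q` under the letter `a`, if there is any, and the initial state
otherwise; it completes the lists of successors, which could be empty, to expressions. -/
def firstSucc (q : Fin n) (a : Fin k) : Fin n :=
  if h : 0 < m then M.step q (a, ⟨0, h⟩) else M.init

/-- The acceptance condition of the Banach–Mazur game. Without letters in the second alphabet all
sections are comeager, and everything is accepted. -/
def gameFormula (m : ℕ) (φ : AccFormula (Fin n)) : AccFormula (Fin (n + n)) :=
  if m = 0 then .neg .fls else
    .or (.neg (.anyOf ((List.finRange n).map (Fin.withPhase true))))
      (.and (.anyOf ((List.finRange n).map (Fin.withPhase false))) φ.bothPhases)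

/-- The alternating automaton of the Banach–Mazur game: the owner of the phase chooses a letter of
the second alphabet and the phase of the next state. -/
def gameAutomaton : AltMuller (Fin k) (Fin (n + n)) where
  init := M.init.withPhase false
  step p a := DL.chain p.phase ((List.finRange m).flatMap fun b =>
    [(M.step p.dropPhase (a, b)).withPhase false, (M.step p.dropPhase (a, b)).withPhase true])
    ((M.firstSucc p.dropPhase a).withPhase false)
  acc := (gameFormula m φ).family

variable {φ} in
theorem isBanachMazur_gameAutomaton (hφ : φ.family = M.acc) (hm : 0 < m) :
    IsBanachMazur M (M.gameAutomaton φ) Fin.dropPhase Fin.phase where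
  proj_init := Fin.dropPhase_withPhase _ _
  ex_init := Fin.phase_withPhase _ _
  exists_state c q := ⟨q.withPhase c, by simp⟩
  isPure p a := DL.isPure_chain _ _ _
  mem_leaves p a p' := by
    simp only [gameAutomaton, DL.mem_leaves_chain, List.mem_flatMap, List.mem_finRange, true_and,
      List.mem_cons, List.not_mem_nil, or_false]
    constructor
    · rintro (⟨b, rfl | rfl⟩ | rfl)
      · exact ⟨b, by simp⟩
      · exact ⟨b, by simp⟩
      · exact ⟨⟨0, hm⟩, by simp [firstSucc, hm]⟩
    · rintro ⟨b, hb⟩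
      refine .inl ⟨b, ?_⟩
      rw [← hb]
      obtain ⟨c, q, rfl⟩ := p'.exists_eq_withPhase
      cases c <;> simp
  mem_acc F := by
    have h (c : Bool) : (∃ p ∈ F, p.phase = c) ↔
        ∃ q, Fin.withPhase c q ∈ F := by
      constructor
      · rintro ⟨p, hp, rfl⟩
        obtain ⟨c, q, rfl⟩ := p.exists_eq_withPhase
        exact ⟨q, by simpa using hp⟩
      · rintro ⟨q, hq⟩
        exact ⟨_, hq, Fin.phase_withPhase c q⟩
    rw [h, h, ← hφ, ← AccFormula.mem_family_bothPhases]
    simp only [gameAutomaton, gameFormula, hm.ne', if_false, AccFormula.family, Set.mem_union,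
      Set.mem_compl_iff, Set.mem_inter_iff, AccFormula.mem_family_anyOf, List.mem_map,
      List.mem_finRange, true_and, exists_exists_eq_and]
    tauto

variable {φ} in
theorem language_gameAutomaton (hφ : φ.family = M.acc) :
    (M.gameAutomaton φ).language = forallStar M.language := by
  rcases Nat.eq_zero_or_pos m with rfl | hm
  · rw [forallStar_language_of_isEmpty]
    refine Set.eq_univ_of_forall fun w => ⟨fun _ => true, fun π _ _ => ?_⟩
    simp [gameAutomaton, gameFormula, AccFormula.family]
  · have : Nonempty (Fin m) := ⟨⟨0, hm⟩⟩
    exact (M.isBanachMazur_gameAutomaton hφ hm).language_eq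

theorem graphSize_gameAutomaton :
    (M.gameAutomaton φ).graphSize = k + (n + n) + (n + n) * (k * (4 * m + 1)) := by
  have h (p : Fin (n + n)) (a : Fin k) : ((M.gameAutomaton φ).step p a).size = 4 * m + 1 := by
    simp only [gameAutomaton, DL.size_chain, List.length_flatMap, List.length_cons,
      List.length_nil, List.map_const', List.length_finRange, List.sum_replicate, smul_eq_mul]
    ring
  simp [AltMuller.graphSize, h]

theorem size_gameFormula_le : (gameFormula m φ).size ≤ 4 * n + 3 * φ.size + 6 := by
  have := φ.size_bothPhases_le
  unfold gameFormula
  split_ifs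
  · simp only [AccFormula.size]; omega
  · simp only [AccFormula.size, AccFormula.size_anyOf, List.length_map, List.length_finRange]
    omega

end DetMuller

/-! ### Computability of the construction -/

/-- The code of the expression for row `j` of the transition table, with connective `o`. -/
def gameRow (c : DetCode) (o j : ℕ) : List ℕ :=
  ((List.range c.2.1).flatMap fun b =>
    [o, c.2.2.2.2.1.getD (j * c.2.1 + b) 0 + 2,
      o, c.2.2.1 + c.2.2.2.2.1.getD (j * c.2.1 + b) 0 + 2]) ++
    [c.2.2.2.2.1.getD (j * c.2.1) c.2.2.2.1 + 2]

/-- The code of the acceptance condition of the game. -/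
def gameCond (c : DetCode) : List ℕ :=
  if c.2.1 = 0 then [1, 0] else
    [3, 1] ++ ((List.range c.2.2.1).flatMap fun q => [3, c.2.2.1 + q + 4]) ++ [0, 2] ++
      ((List.range c.2.2.1).flatMap fun q => [3, q + 4]) ++ [0] ++
      (c.2.2.2.2.2.flatMap fun x => if x < 4 then [x] else [3, x, c.2.2.1 + x])

/-- The construction of the alternating automaton on the level of codes. -/
def gameCode (c : DetCode) : AltCode :=
  (c.1, c.2.2.1 + c.2.2.1, c.2.2.2.1,
    (List.range (c.2.2.1 * c.1)).map (gameRow c 0) ++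
      (List.range (c.2.2.1 * c.1)).map (gameRow c 1),
    gameCond c)

section Primrec

open Primrec

theorem primrec_gameRow (o : ℕ) : Primrec₂ fun (c : DetCode) (j : ℕ) => gameRow c o j := by
  have hm : Primrec fun c : DetCode => c.2.1 := fst.comp snd
  have hn : Primrec fun c : DetCode => c.2.2.1 := fst.comp (snd.comp snd)
  have hi : Primrec fun c : DetCode => c.2.2.2.1 := fst.comp (snd.comp (snd.comp snd))
  have hT : Primrec fun c : DetCode => c.2.2.2.2.1 :=
    fst.comp (snd.comp (snd.comp (snd.comp snd)))
  -- the last entry has a default that depends on the code, hence the detour through `option_getD`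
  have hlast : Primrec fun p : DetCode × ℕ => p.1.2.2.2.2.1.getD (p.2 * p.1.2.1) p.1.2.2.2.1 := by
    have : Primrec fun p : DetCode × ℕ => (p.1.2.2.2.2.1[p.2 * p.1.2.1]?).getD p.1.2.2.2.1 :=
      option_getD.comp (list_getElem?.comp (hT.comp fst) (nat_mul.comp snd (hm.comp fst)))
        (hi.comp fst)
    exact this.of_eq fun p => by rw [List.getD_eq_getElem?_getD]
  have hentry : Primrec fun r : (DetCode × ℕ) × ℕ =>
      r.1.1.2.2.2.2.1.getD (r.1.2 * r.1.1.2.1 + r.2) 0 :=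
    (list_getD 0).comp (hT.comp (fst.comp fst))
      (nat_add.comp (nat_mul.comp (snd.comp fst) (hm.comp (fst.comp fst))) snd)
  have hadd {β : Type} [Primcodable β] {f : β → ℕ} (hf : Primrec f) (c : ℕ) :
      Primrec fun x => f x + c := nat_add.comp hf (const c)
  have hbody : Primrec₂ fun (p : DetCode × ℕ) (b : ℕ) =>
      [o, p.1.2.2.2.2.1.getD (p.2 * p.1.2.1 + b) 0 + 2,
        o, p.1.2.2.1 + p.1.2.2.2.2.1.getD (p.2 * p.1.2.1 + b) 0 + 2] :=
    list_cons.comp (const o) (list_cons.comp (hadd hentry 2) (list_cons.comp (const o)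
      (list_cons.comp (hadd (nat_add.comp (hn.comp (fst.comp fst)) hentry) 2) (const []))))
  exact list_append.comp (list_flatMap (list_range.comp (hm.comp fst)) hbody)
    (list_cons.comp (hadd hlast 2) (const []))

theorem primrec_gameCond : Primrec gameCond := by
  have hm : Primrec fun c : DetCode => c.2.1 := fst.comp snd
  have hn : Primrec fun c : DetCode => c.2.2.1 := fst.comp (snd.comp snd)
  have hF : Primrec fun c : DetCode => c.2.2.2.2.2 :=
    snd.comp (snd.comp (snd.comp (snd.comp snd)))
  have hadd {β : Type} [Primcodable β] {f : β → ℕ} (hf : Primrec f) (c : ℕ) :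
      Primrec fun x => f x + c := nat_add.comp hf (const c)
  have hex : Primrec₂ fun (c : DetCode) (q : ℕ) => [3, c.2.2.1 + q + 4] :=
    list_cons.comp (const 3)
      (list_cons.comp (hadd (nat_add.comp (hn.comp fst) snd) 4) (const []))
  have hall : Primrec₂ fun (_ : DetCode) (q : ℕ) => [3, q + 4] :=
    list_cons.comp (const 3) (list_cons.comp (hadd snd 4) (const []))
  have hsub : Primrec₂ fun (c : DetCode) (x : ℕ) =>
      if x < 4 then [x] else [3, x, c.2.2.1 + x] :=
    ite (nat_lt.comp snd (const 4)) (list_cons.comp snd (const []))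
      (list_cons.comp (const 3) (list_cons.comp snd
        (list_cons.comp (nat_add.comp (hn.comp fst) snd) (const []))))
  exact ite (Primrec.eq.comp hm (const 0)) (const [1, 0])
    (list_append.comp (list_append.comp (list_append.comp (list_append.comp (list_append.comp
      (const [3, 1]) (list_flatMap (list_range.comp hn) hex)) (const [0, 2]))
      (list_flatMap (list_range.comp hn) hall)) (const [0])) (list_flatMap hF hsub))

theorem primrec_gameCode : Primrec gameCode := by
  have hn : Primrec fun c : DetCode => c.2.2.1 := fst.comp (snd.comp snd)
  have hi : Primrec fun c : DetCode => c.2.2.2.1 := fst.comp (snd.comp (snd.comp snd))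
  have hrange : Primrec fun c : DetCode => List.range (c.2.2.1 * c.1) :=
    list_range.comp (nat_mul.comp hn fst)
  exact fst.pair ((nat_add.comp hn hn).pair (hi.pair ((list_append.comp
    (list_map hrange (primrec_gameRow 0)) (list_map hrange (primrec_gameRow 1))).pair
    primrec_gameCond)))

end Primrec

/-! ### The code of the alternating automaton -/

theorem getD_flatMap_of_length_eq {β γ : Type*} {f : β → List γ} {c r : ℕ} (hr : r < c) (d : γ)
    (l : List β) (hf : ∀ x ∈ l, (f x).length = c) (i : ℕ) (hi : i < l.length) :
    (l.flatMap f).getD (i * c + r) d = (f l[i]).getD r d := by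
  induction l generalizing i with
  | nil => simp at hi
  | cons x l ih =>
    have hx := hf x List.mem_cons_self
    cases i with
    | zero =>
      rw [List.flatMap_cons, List.getD_append _ _ _ _ (by omega)]
      simp
    | succ i =>
      have e : (i + 1) * c + r = i * c + r + c := by ring
      rw [List.flatMap_cons, List.getD_append_right _ _ _ _ (by rw [hx, e]; omega), hx, e,
        Nat.add_sub_cancel, ih (fun y hy => hf y (List.mem_cons_of_mem _ hy)) i
          (by simpa using hi)]
      simp

theorem map_range_eq_map_finRange {β : Type*} (n : ℕ) (f : ℕ → β) :
    (List.range n).map f = (List.finRange n).map fun i : Fin n => f i := by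
  rw [← List.map_coe_finRange_eq_range, List.map_map]
  rfl

theorem flatMap_range_eq_flatMap_finRange {β : Type*} (n : ℕ) (f : ℕ → List β) :
    (List.range n).flatMap f = (List.finRange n).flatMap fun i : Fin n => f i := by
  rw [← List.map_coe_finRange_eq_range, List.flatMap_map]

theorem range_mul_eq_flatMap (n k : ℕ) : List.range (n * k) =
    (List.finRange n).flatMap fun q : Fin n =>
      (List.finRange k).map fun a : Fin k => (q : ℕ) * k + a := by
  have h : List.range (n * k) =
      (List.range n).flatMap fun q => (List.range k).map fun a => q * k + a := by
    induction n with
    | zero => simp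
    | succ n ih =>
      rw [Nat.succ_mul, List.range_add, ih, List.range_succ, List.flatMap_append]
      simp
  rw [h]
  simp only [flatMap_range_eq_flatMap_finRange, map_range_eq_map_finRange]

theorem finRange_add_self (n : ℕ) : List.finRange (n + n) =
    (List.finRange n).map (Fin.withPhase false) ++
      (List.finRange n).map (Fin.withPhase true) := by
  simp only [List.finRange, List.ofFn_add, List.map_ofFn]
  rfl

namespace DetMuller

variable {k m n : ℕ} (M : DetMuller (Fin k × Fin m) (Fin n)) (φ : AccFormula (Fin n))

theorem getD_table (q : Fin n) (a : Fin k) (b : Fin m) (d : ℕ) :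
    (M.code φ).2.2.2.2.1.getD (((q : ℕ) * k + a) * m + b) d = M.step q (a, b) := by
  have hlen : ∀ (q : Fin n), ((List.finRange k).flatMap fun a =>
      (List.finRange m).map fun b => (M.step q (a, b) : ℕ)).length = k * m := by
    intro q
    simp [List.length_flatMap]
  have hlt : (a : ℕ) * m + b < k * m :=
    calc (a : ℕ) * m + b < a * m + m := by omega
      _ = (a + 1) * m := by ring
      _ ≤ k * m := Nat.mul_le_mul_right _ a.2
  have e : ((q : ℕ) * k + a) * m + b = q * (k * m) + (a * m + b) := by ring
  rw [e]
  refine (getD_flatMap_of_length_eq hlt d _ (fun q _ => hlen q) q (by simp)).trans ?_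
  refine (getD_flatMap_of_length_eq b.2 d _ (by simp) a (by simp)).trans ?_
  simp [List.getD_eq_getElem?_getD]

theorem gameRow_code (o : Bool) (q : Fin n) (a : Fin k) :
    gameRow (M.code φ) o.toNat ((q : ℕ) * k + a) =
      ((M.gameAutomaton φ).step (q.withPhase o) a).code := by
  have hlast : (M.code φ).2.2.2.2.1.getD (((q : ℕ) * k + a) * m)
      (M.code φ).2.2.2.1 = M.firstSucc q a := by
    rcases Nat.eq_zero_or_pos m with rfl | hm
    · simp [code, firstSucc]
    · rw [firstSucc, dif_pos hm]
      exact M.getD_table φ q a ⟨0, hm⟩ _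
  have hm : (M.code φ).2.1 = m := rfl
  have hn : (M.code φ).2.2.1 = n := rfl
  simp only [gameRow, gameAutomaton, DL.code_chain, hm, hn, hlast,
    Fin.phase_withPhase, Fin.dropPhase_withPhase, Fin.val_withPhase_false]
  rw [flatMap_range_eq_flatMap_finRange, List.flatMap_assoc]
  simp only [getD_table]
  rfl

theorem gameCond_code : gameCond (M.code φ) = (gameFormula m φ).code := by
  have hm : (M.code φ).2.1 = m := rfl
  have hn : (M.code φ).2.2.1 = n := rfl
  have hF : (M.code φ).2.2.2.2.2 = φ.code := rfl
  simp only [gameCond, gameFormula, hm, hn, hF]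
  split_ifs
  · rfl
  · simp only [AccFormula.code, AccFormula.code_anyOf, AccFormula.code_bothPhases,
      List.flatMap_map, flatMap_range_eq_flatMap_finRange]
    simp

theorem gameCode_code : gameCode (M.code φ) = (M.gameAutomaton φ).code (gameFormula m φ) := by
  have hk : (M.code φ).1 = k := rfl
  have hn : (M.code φ).2.2.1 = n := rfl
  have hi : (M.code φ).2.2.2.1 = M.init := rfl
  have hrow (o : Bool) :
      (List.range (n * k)).map (gameRow (M.code φ) o.toNat) =
        ((List.finRange n).map (Fin.withPhase o)).flatMap fun p =>
          (List.finRange k).map fun a => ((M.gameAutomaton φ).step p a).code := by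
    rw [range_mul_eq_flatMap, List.map_flatMap, List.flatMap_map]
    refine List.flatMap_congr fun q _ => ?_
    rw [List.map_map]
    exact List.map_congr_left fun a _ => M.gameRow_code φ o q a
  simp only [gameCode, AltMuller.code, hk, hn, hi, gameCond_code, finRange_add_self,
    List.flatMap_append]
  rw [← hrow false, ← hrow true]
  rfl

end DetMuller

theorem mainTheorem10 :
    (∀ (S G Q : Type*) [Finite S] [Finite G] [Finite Q] (M : DetMuller (S × G) Q),
      IsOmegaRegular (forallStar M.language)) ∧
    (∃ (f : DetCode → AltCode) (p : Polynomial ℕ), Computable f ∧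
      ∀ (k m n : ℕ) (M : DetMuller (Fin k × Fin m) (Fin n)) (φ : AccFormula (Fin n)),
        φ.family = M.acc →
        ∃ (n' : ℕ) (B : AltMuller (Fin k) (Fin n')) (ψ : AccFormula (Fin n')),
          ψ.family = B.acc ∧
          f (M.code φ) = B.code ψ ∧
          B.language = forallStar M.language ∧
          n' ≤ p.eval n ∧
          B.graphSize ≤ p.eval M.graphSize ∧
          B.graphSize + ψ.size ≤ p.eval (M.graphSize + φ.size)) := by
  have key (k m n s : ℕ) {t : ℕ} (ht : t ≤ 4 * n + 3 * s + 6) :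
      k + (n + n) + (n + n) * (k * (4 * m + 1)) + t ≤
        (k + m + n + n * k * m + s) ^ 2 + 20 * (k + m + n + n * k * m + s) + 20 := by
    have h : (k + n) ^ 2 ≤ (k + m + n + n * k * m + s) ^ 2 :=
      Nat.pow_le_pow_left (by omega) 2
    have e : (n + n) * (k * (4 * m + 1)) = 8 * (n * k * m) + 2 * (k * n) := by ring
    have h' : 2 * (k * n) ≤ (k + n) ^ 2 := by
      rw [add_sq, ← mul_assoc]
      omega
    rw [e]
    omega
  refine ⟨fun S G Q _ _ _ M => M.isOmegaRegular_forallStar, gameCode,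
    Polynomial.X ^ 2 + Polynomial.C 20 * Polynomial.X + Polynomial.C 20,
    primrec_gameCode.to_comp, fun k m n M φ hφ => ⟨n + n, M.gameAutomaton φ,
      DetMuller.gameFormula m φ, rfl, M.gameCode_code φ, M.language_gameAutomaton hφ, ?_, ?_, ?_⟩⟩
  all_goals simp only [Polynomial.eval_add, Polynomial.eval_mul, Polynomial.eval_pow,
    Polynomial.eval_X, Polynomial.eval_C]
  · nlinarith
  · rw [M.graphSize_gameAutomaton φ, DetMuller.graphSize]
    exact key k m n 0 (t := 0) (Nat.zero_le _)
  · rw [M.graphSize_gameAutomaton φ, DetMuller.graphSize]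
    exact key k m n _ (DetMuller.size_gameFormula_le φ)
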